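/- Let $\mathcal H$ be a complex separable Hilbert space, with inner product linear in the second argument, and let $T$ be a positive, possibly unbounded, self-adjoint operator on $\mathcal H$ (positive means $\langle\psi,T\psi\rangle\ge 0$ for all $\psi\in D(T)$). Let $\mathcal S_1(\mathcal H)$ be the space of trace-class operators on $\mathcal H$, $\mathcal S_1^{\mathrm{sa}}(\mathcal H)$ the set of its self-adjoint elements, and $\mathcal S_1^+(\mathcal H)$ the set of its positive (semidefinite) elements. For a positive self-adjoint operator $V$ and $\gamma\in\mathcal S_1^+(\mathcal H)$ put $$\operatorname{Tr}(V\gamma):=\sup_{\varepsilon>0}\operatorname{Tr}(V_\varepsilon\gamma)\in[0,+\infty],\qquad V_\varepsilon:=V(1+\varepsilon V)^{-1}.$$ Define $X^+:=\{\gamma\in\mathcal S_1^+(\mathcal H)\mid \operatorname{Tr}(T\gamma)<+\infty\}$ and $X:=X^+-X^+=\{\gamma^+-\gamma^-\mid\gamma^\pm\in X^+\}$, and define $\|\cdot\|_X:\mathcal S_1(\mathcal H)\to[0,+\infty]$ by $$\|\gamma\|_X:=\inf\bigl\{\operatorname{Tr}((1+T)\gamma^+)+\operatorname{Tr}((1+T)\gamma^-)\;\big|\;\gamma^\pm\in\mathcal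 S_1^+(\mathcal H),\ \gamma=\gamma^+-\gamma^-\bigr\},\qquad \inf\emptyset=+\infty .$$ Then: 1. $\|\cdot\|_X:\mathcal S_1(\mathcal H)\to[0,+\infty]$ is lower semicontinuous with respect to the weak-$*$ topology of $\mathcal S_1(\mathcal H)$, that is, the coarsest topology for which $A\mapsto\operatorname{Tr}(VA)$ is continuous for every compact operator $V$ on $\mathcal H$. In particular, if $\gamma_n,\gamma\in\mathcal S_1(\mathcal H)$ and $\operatorname{Tr}(V(\gamma_n-\gamma))\to0$ for every compact $V$, then $\|\gamma\|_X\le\liminf_{n\to\infty}\|\gamma_n\|_X$. 2. $X\subset\mathcal S_1^{\mathrm{sa}}(\mathcal H)$, and $(X,\|\cdot\|_X)$ is a real Banach space: $X$ is a real linear subspace, $\|\cdot\|_X$ is finite on $X$ and is a norm there, and $X$ is complete with respect to this norm. -/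

import Mathlib

open scoped ENNReal Topology InnerProductSpace
open Filter

set_option linter.unusedSectionVars false

noncomputable section

namespace RDM

/-! ### Trace and trace-class operators on a Hilbert space -/

section Trace

variable (H : Type*) [NormedAddCommGroup H] [InnerProductSpace ℂ H] [CompleteSpace H]

/-- The index set of a fixed Hilbert basis (complete orthonormal system) of `H`. -/
def basisIndex : Set H := (exists_hilbertBasis ℂ H).choose

/-- A fixed Hilbert basis of `H`, used to compute traces. -/
def stdBasis : HilbertBasis (basisIndex H) ℂ H := (exists_hilbertBasis ℂ H).choose_spec.choose

variable {H}

/-- The trace `∑ᵢ ⟨eᵢ, A eᵢ⟩ ∈ [0, ∞]` of a positive bounded operator. -/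
def posTrace (A : H →L[ℂ] H) : ℝ≥0∞ :=
  ∑' i, ENNReal.ofReal (RCLike.re ⟪stdBasis H i, A (stdBasis H i)⟫_ℂ)

/-- `A` is trace class: `Tr |A| < ∞`, where `|A| = (A* A)^{1/2}`. -/
def IsTraceClass (A : H →L[ℂ] H) : Prop := posTrace (CFC.abs A) < ∞

/-- The trace `∑ᵢ ⟨eᵢ, A eᵢ⟩ ∈ ℂ` of a trace-class operator. -/
def trace (A : H →L[ℂ] H) : ℂ := ∑' i, ⟪stdBasis H i, A (stdBasis H i)⟫_ℂ

theorem ofReal_norm_sq_eq_tsum {κ : Type*} (d : HilbertBasis κ ℂ H) (x : H) :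
    ENNReal.ofReal (‖x‖ ^ 2) = ∑' j, ENNReal.ofReal (‖⟪d j, x⟫_ℂ‖ ^ 2) := by
  have h : HasSum (fun j => ‖⟪d j, x⟫_ℂ‖ ^ 2) (‖x‖ ^ 2) := by
    have h1 := (d.hasSum_inner_mul_inner x x).mapL (RCLike.reCLM (K := ℂ))
    simp only [RCLike.reCLM_apply] at h1
    rw [inner_self_eq_norm_sq] at h1
    refine h1.congr_fun ?_
    intro j
    rw [← inner_conj_symm x (d j), RCLike.conj_mul]
    norm_cast
  rw [← h.tsum_eq, ENNReal.ofReal_tsum_of_nonneg (fun _ => by positivity) h.summable]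

theorem tsum_norm_sq_eq {ι κ : Type*} (b : HilbertBasis ι ℂ H) (c : HilbertBasis κ ℂ H)
    (S : H →L[ℂ] H) :
    ∑' i, ENNReal.ofReal (‖S (b i)‖ ^ 2)
      = ∑' j, ENNReal.ofReal (‖ContinuousLinearMap.adjoint S (c j)‖ ^ 2) := by
  calc ∑' i, ENNReal.ofReal (‖S (b i)‖ ^ 2)
      = ∑' i, ∑' j, ENNReal.ofReal (‖⟪c j, S (b i)⟫_ℂ‖ ^ 2) :=
        tsum_congr fun i => ofReal_norm_sq_eq_tsum c _
    _ = ∑' j, ∑' i, ENNReal.ofReal (‖⟪c j, S (b i)⟫_ℂ‖ ^ 2) := ENNReal.tsum_comm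
    _ = ∑' j, ∑' i, ENNReal.ofReal
          (‖⟪b i, ContinuousLinearMap.adjoint S (c j)⟫_ℂ‖ ^ 2) := by
        refine tsum_congr fun j => tsum_congr fun i => ?_
        rw [ContinuousLinearMap.adjoint_inner_right, norm_inner_symm]
    _ = _ := tsum_congr fun j => (ofReal_norm_sq_eq_tsum b _).symm

/-- The trace of a positive operator may be computed in every Hilbert basis. -/
theorem posTrace_eq {ι : Type*} (b : HilbertBasis ι ℂ H) {A : H →L[ℂ] H} (hA : 0 ≤ A) :
    posTrace A = ∑' i, ENNReal.ofReal (RCLike.re ⟪b i, A (b i)⟫_ℂ) := by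
  have hS : IsSelfAdjoint (CFC.sqrt A) := (CFC.sqrt_nonneg A).isSelfAdjoint
  have key : ∀ x : H, RCLike.re ⟪x, A x⟫_ℂ = ‖CFC.sqrt A x‖ ^ 2 := by
    intro x
    conv_lhs => rw [← CFC.sqrt_mul_sqrt_self A hA]
    change RCLike.re ⟪x, CFC.sqrt A (CFC.sqrt A x)⟫_ℂ = _
    rw [← ContinuousLinearMap.adjoint_inner_left,
      hS.adjoint_eq, inner_self_eq_norm_sq]
  unfold posTrace
  simp_rw [key]
  rw [tsum_norm_sq_eq _ b, hS.adjoint_eq]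

end Trace

/-- The space `𝓢₁(H)` of trace-class operators. -/
def TraceClass (H : Type*) [NormedAddCommGroup H] [InnerProductSpace ℂ H] [CompleteSpace H] :=
  {A : H →L[ℂ] H // IsTraceClass A}

/-- The operator underlying an element of `𝓢₁(H)`. -/
def TraceClass.op {H : Type*} [NormedAddCommGroup H] [InnerProductSpace ℂ H] [CompleteSpace H]
    (A : TraceClass H) : H →L[ℂ] H := A.1

/-- The weak-* topology of `𝓢₁(H) = 𝓚(H)*`: the coarsest topology making `A ↦ Tr (V A)` continuous
for every compact operator `V`. -/
instance TraceClass.weakStarTopology (H : Type*) [NormedAddCommGroup H] [InnerProductSpace ℂ H]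
    [CompleteSpace H] : TopologicalSpace (TraceClass H) :=
  TopologicalSpace.induced
    (fun (A : TraceClass H) (V : {V : H →L[ℂ] H // IsCompactOperator V}) =>
      trace ((V : H →L[ℂ] H) ∘L A.op))
    Pi.topologicalSpace

/-! ### Positive unbounded operators and `Tr (T γ)` -/

section Unbounded

variable {H : Type*} [NormedAddCommGroup H] [InnerProductSpace ℂ H] [CompleteSpace H]

/-- A possibly unbounded operator is positive if it is self-adjoint (in particular densely defined)
and positive semidefinite. -/
structure IsPositiveOp (T : H →ₗ.[ℂ] H) : Prop where
  selfAdjoint : IsSelfAdjoint T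
  nonneg : ∀ ψ : T.domain, 0 ≤ RCLike.re ⟪(ψ : H), T ψ⟫_ℂ

/-- `B` is the bounded operator `T (1 + ε T)⁻¹`: the operator `1 + ε T` is a bijection from `D(T)`
onto `H`, and `B` maps `ψ + ε T ψ` to `T ψ`. -/
def IsRegularization (T : H →ₗ.[ℂ] H) (ε : ℝ) (B : H →L[ℂ] H) : Prop :=
  Function.Bijective (fun ψ : T.domain => (ψ : H) + (ε : ℂ) • T ψ) ∧
    ∀ ψ : T.domain, B ((ψ : H) + (ε : ℂ) • T ψ) = T ψ

theorem IsRegularization.unique {T : H →ₗ.[ℂ] H} {ε : ℝ} {B C : H →L[ℂ] H}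
    (hB : IsRegularization T ε B) (hC : IsRegularization T ε C) : B = C := by
  ext φ
  obtain ⟨ψ, rfl⟩ := hB.1.2 φ
  exact (hB.2 ψ).trans (hC.2 ψ).symm

open Classical in
/-- The bounded operator `T_ε = T (1 + ε T)⁻¹`. -/
def regularization (T : H →ₗ.[ℂ] H) (ε : ℝ) : H →L[ℂ] H :=
  if h : ∃ B, IsRegularization T ε B then h.choose else 0

theorem sq_bound {T : H →ₗ.[ℂ] H} (hT : IsPositiveOp T) {ε : ℝ} (hε : 0 < ε)
    (ψ : T.domain) :
    ‖(ψ : H)‖ ^ 2 + ε ^ 2 * ‖T ψ‖ ^ 2 ≤ ‖(ψ : H) + (ε : ℂ) • T ψ‖ ^ 2 := by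
  have h := norm_add_sq (𝕜 := ℂ) (ψ : H) ((ε : ℂ) • T ψ)
  rw [inner_smul_right, norm_smul, RCLike.re_to_complex, Complex.re_ofReal_mul,
    Complex.norm_real, Real.norm_eq_abs, mul_pow, sq_abs] at h
  have h2 := mul_nonneg hε.le (hT.nonneg ψ)
  rw [RCLike.re_to_complex] at h2
  linarith

/-- For a positive operator `T` and `ε > 0` the bounded operator `T (1 + ε T)⁻¹` exists. -/
theorem exists_isRegularization {T : H →ₗ.[ℂ] H} (hT : IsPositiveOp T) {ε : ℝ} (hε : 0 < ε) :
    ∃ B, IsRegularization T ε B := by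
  have hdense := hT.selfAdjoint.dense_domain
  have hadj : T.adjoint = T := LinearPMap.isSelfAdjoint_def.mp hT.selfAdjoint
  have hclosed : IsClosed (T.graph : Set (H × H)) := hT.selfAdjoint.isClosed
  have : CompleteSpace T.graph := hclosed.completeSpace_coe
  let F : T.graph →L[ℂ] H :=
    (ContinuousLinearMap.fst ℂ H H + (ε : ℂ) • ContinuousLinearMap.snd ℂ H H) ∘L T.graph.subtypeL
  have hF : ∀ p : T.graph, F p = p.1.1 + (ε : ℂ) • p.1.2 := fun p => rfl
  have hbd : ∀ p : T.graph, ‖p.1.1‖ ≤ ‖F p‖ ∧ ‖p.1.2‖ ≤ ε⁻¹ * ‖F p‖ := by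
    intro p
    obtain ⟨ψ, h1, h2⟩ := LinearPMap.mem_graph_iff _ |>.mp p.2
    have h := sq_bound hT hε ψ
    rw [h1, h2, ← hF] at h
    constructor
    · refine le_of_sq_le_sq ?_ (norm_nonneg _)
      nlinarith [sq_nonneg (ε * ‖p.1.2‖)]
    · rw [inv_mul_eq_div, le_div_iff₀ hε]
      refine le_of_sq_le_sq ?_ (norm_nonneg _)
      nlinarith [sq_nonneg ‖p.1.1‖]
  have hanti : AntilipschitzWith (Real.toNNReal (max 1 ε⁻¹)) F := by
    refine F.antilipschitz_of_bound ?_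
    intro p
    rw [Real.coe_toNNReal _ (le_max_of_le_left zero_le_one)]
    change max ‖p.1.1‖ ‖p.1.2‖ ≤ _
    refine max_le ((hbd p).1.trans ?_) ((hbd p).2.trans ?_)
    · exact le_mul_of_one_le_left (norm_nonneg _) (le_max_left _ _)
    · exact mul_le_mul_of_nonneg_right (le_max_right _ _) (norm_nonneg _)
  have hker : F.ker = ⊥ := LinearMap.ker_eq_bot.mpr hanti.injective
  have hrc : IsClosed (F.range : Set H) := by
    have h := hanti.isClosed_range F.uniformContinuous
    exact h
  have hrange : F.range = ⊤ := by
    have : CompleteSpace F.range := hrc.completeSpace_coe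
    rw [← Submodule.orthogonal_eq_bot_iff, Submodule.eq_bot_iff]
    intro φ hφ
    have horth : ∀ ψ : T.domain, ⟪φ, (ψ : H) + (ε : ℂ) • T ψ⟫_ℂ = 0 := by
      intro ψ
      rw [Submodule.mem_orthogonal'] at hφ
      exact hφ _ ⟨⟨((ψ : H), T ψ), T.mem_graph ψ⟩, rfl⟩
    have hεC : (ε : ℂ) ≠ 0 := by exact_mod_cast hε.ne'
    have hw : ∀ ψ : T.domain, ⟪-((ε : ℂ)⁻¹ • φ), (ψ : H)⟫_ℂ = ⟪φ, T ψ⟫_ℂ := by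
      intro ψ
      have h := horth ψ
      rw [inner_add_right, inner_smul_right] at h
      rw [inner_neg_left, inner_smul_left]
      simp only [map_inv₀, Complex.conj_ofReal]
      field_simp
      linear_combination -h
    have hmem' : φ ∈ T.adjoint.domain := LinearPMap.mem_adjoint_domain_of_exists _ ⟨_, hw⟩
    have hmem : φ ∈ T.domain := by rwa [hadj] at hmem'
    have h0 := sq_bound hT hε ⟨φ, hmem⟩
    have h1 := horth ⟨φ, hmem⟩
    have h2 := hT.nonneg ⟨φ, hmem⟩
    rw [inner_add_right, inner_smul_right] at h1
    have h3 := congrArg Complex.re h1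
    rw [Complex.add_re, Complex.re_ofReal_mul] at h3
    have h4 : (⟪φ, φ⟫_ℂ).re = ‖φ‖ ^ 2 := inner_self_eq_norm_sq (𝕜 := ℂ) φ
    rw [RCLike.re_to_complex] at h2
    simp only [h4, Complex.zero_re] at h3
    have h5 := mul_nonneg hε.le h2
    have h6 : ‖φ‖ ^ 2 ≤ 0 := by linarith
    exact norm_eq_zero.mp (pow_eq_zero_iff two_ne_zero |>.mp (le_antisymm h6 (sq_nonneg _)))
  let e : T.graph ≃L[ℂ] H := ContinuousLinearEquiv.ofBijective F hker hrange
  refine ⟨(ContinuousLinearMap.snd ℂ H H) ∘L T.graph.subtypeL ∘L (e.symm : H →L[ℂ] T.graph),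
    ⟨?_, ?_⟩, ?_⟩
  · intro x y hxy
    have : (⟨((x : H), T x), T.mem_graph x⟩ : T.graph) = ⟨((y : H), T y), T.mem_graph y⟩ :=
      hanti.injective hxy
    exact Subtype.ext (congrArg (fun p : T.graph => p.1.1) this)
  · intro φ
    obtain ⟨p, hp⟩ := e.surjective φ
    obtain ⟨ψ, h1, h2⟩ := LinearPMap.mem_graph_iff _ |>.mp p.2
    refine ⟨ψ, ?_⟩
    change (ψ : H) + (ε : ℂ) • T ψ = φ
    rw [h1, h2, ← hp]
    rfl
  · intro ψ
    have h : e ⟨((ψ : H), T ψ), T.mem_graph ψ⟩ = (ψ : H) + (ε : ℂ) • T ψ := rfl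
    rw [← h]
    simp

theorem isRegularization_regularization {T : H →ₗ.[ℂ] H} (hT : IsPositiveOp T) {ε : ℝ}
    (hε : 0 < ε) : IsRegularization T ε (regularization T ε) := by
  have h := exists_isRegularization hT hε
  rw [regularization, dif_pos h]
  exact h.choose_spec

/-- `Tr (T γ) = sup_{ε > 0} Tr (T_ε γ) ∈ [0, ∞]` for a positive operator `T` and a positive
trace-class operator `γ`. -/
def energyTrace (T : H →ₗ.[ℂ] H) (γ : H →L[ℂ] H) : ℝ≥0∞ :=
  ⨆ (ε : ℝ) (_ : 0 < ε), ENNReal.ofReal (RCLike.re (trace (regularization T ε ∘L γ)))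

/-- The operator `1 + T` with domain `D(T)`. -/
def oneAdd (T : H →ₗ.[ℂ] H) : H →ₗ.[ℂ] H := (LinearMap.id : H →ₗ[ℂ] H) +ᵥ T

/-- `1 + T` is again a positive operator. -/
theorem IsPositiveOp.oneAdd {T : H →ₗ.[ℂ] H} (hT : IsPositiveOp T) : IsPositiveOp (oneAdd T) := by
  have hdense := hT.selfAdjoint.dense_domain
  have hadj : T.adjoint = T := LinearPMap.isSelfAdjoint_def.mp hT.selfAdjoint
  have hformal : T.IsFormalAdjoint T := by
    have h := LinearPMap.adjoint_isFormalAdjoint hdense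
    rwa [hadj] at h
  have hdense' : Dense ((RDM.oneAdd T).domain : Set H) := hdense
  have hf' : (RDM.oneAdd T).IsFormalAdjoint (RDM.oneAdd T) := by
    intro x y
    have h := hformal x y
    change ⟪(x : H) + T x, (y : H)⟫_ℂ = ⟪(x : H), (y : H) + T y⟫_ℂ
    rw [inner_add_left, inner_add_right, h]
  refine ⟨?_, ?_⟩
  · rw [LinearPMap.isSelfAdjoint_def]
    refine (LinearPMap.eq_of_le_of_domain_eq (LinearPMap.IsFormalAdjoint.le_adjoint hdense' hf')
      (le_antisymm (LinearPMap.IsFormalAdjoint.le_adjoint hdense' hf').1 ?_)).symm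
    intro φ hφ
    change φ ∈ T.domain
    suffices φ ∈ T.adjoint.domain by rwa [hadj] at this
    refine LinearPMap.mem_adjoint_domain_of_exists _
      ⟨(RDM.oneAdd T).adjoint ⟨φ, hφ⟩ - φ, fun x => ?_⟩
    have h := LinearPMap.adjoint_isFormalAdjoint hdense' ⟨φ, hφ⟩ x
    change ⟪(RDM.oneAdd T).adjoint ⟨φ, hφ⟩, (x : H)⟫_ℂ = ⟪φ, (x : H) + T x⟫_ℂ at h
    rw [inner_sub_left, h, inner_add_right, add_sub_cancel_left]
  · intro ψ
    change 0 ≤ RCLike.re ⟪(ψ : H), (ψ : H) + T ψ⟫_ℂ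
    rw [inner_add_right, map_add]
    exact add_nonneg inner_self_nonneg (hT.nonneg ψ)

/-! ### The space `X` and the `X`-norm -/

/-- The cone `X⁺` of positive trace-class operators with finite kinetic energy `Tr (T γ)`. -/
def XPos (T : H →ₗ.[ℂ] H) : Set (H →L[ℂ] H) :=
  {γ | γ.IsPositive ∧ IsTraceClass γ ∧ energyTrace T γ < ∞}

/-- `X = X⁺ - X⁺`. -/
def XSpace (T : H →ₗ.[ℂ] H) : Set (H →L[ℂ] H) :=
  {γ | ∃ γp ∈ XPos T, ∃ γm ∈ XPos T, γ = γp - γm}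

/-- The `X`-norm, with values in `[0, ∞]`: the infimum of `Tr ((1+T) γ⁺) + Tr ((1+T) γ⁻)` over all
decompositions `γ = γ⁺ - γ⁻` into positive trace-class operators (`∞` if there is none). -/
def xNorm (T : H →ₗ.[ℂ] H) (γ : H →L[ℂ] H) : ℝ≥0∞ :=
  sInf {t | ∃ γp γm : H →L[ℂ] H, (γp.IsPositive ∧ IsTraceClass γp) ∧
    (γm.IsPositive ∧ IsTraceClass γm) ∧ γ = γp - γm ∧
    t = energyTrace (oneAdd T) γp + energyTrace (oneAdd T) γm}

end Unbounded

/-- The subset `X` of the real vector space `E`, with the extended-real-valued function `N`, is a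
real Banach space: `X` is a real linear subspace, `N` is finite on `X` and restricts to a norm
there, and `X` is complete for this norm. -/
def IsRealBanachSpace {E : Type*} [AddCommGroup E] [Module ℝ E] (X : Set E) (N : E → ℝ≥0∞) :
    Prop :=
  ∃ S : Submodule ℝ E, (S : Set E) = X ∧ (∀ x ∈ X, N x < ∞) ∧
    letI : Norm S := ⟨fun x => (N x).toReal⟩
    ∃ core : NormedSpace.Core ℝ S,
      letI : NormedAddCommGroup S := NormedAddCommGroup.ofCore core
      CompleteSpace S

end RDM

end

open scoped ENNReal Topology InnerProductSpace
open Filter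

noncomputable section

namespace RDM

section Trace

variable {H : Type*} [NormedAddCommGroup H] [InnerProductSpace ℂ H] [CompleteSpace H]

/-! ### The trace of positive operators -/

/-! Everything reduces to sums of quadratic forms. For bounded `B ≥ 0` and positive trace-class `γ`,
`Tr (Bγ)` is the sum of the forms of `γ^{1/2} B γ^{1/2}`, or equally of `B^{1/2} γ B^{1/2}`, over a
basis. The first version compares different `B`; the second is linear in `γ` and lower
semicontinuous under weak operator convergence. The variational formula for the form of `T_ε` gives
`T_ε ≤ (1+T)_ε ≤ T_ε + 1` and `1 ≤ 2 (1+T)_1`. Hence the energy of `1+T` is finite exactly on `X⁺`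
and controls the trace and the operator norm.

Lower semicontinuity is the direct method (`xNorm_le_of_tendsto`). Rank-one test operators turn
weak-* into weak operator convergence. Near-optimal pieces `γ⁺`, `γ⁻` are bounded in operator norm,
so they converge weakly along an ultrafilter; the limits are positive and trace class, decompose the
limit operator, and have no more energy.

For completeness, an `X`-Cauchy sequence converges in operator norm, and semicontinuity applied to
`u n - u m` as `m → ∞` upgrades this to the `X`-norm. That `X` lies in the trace class is `Tr |P -
M| ≤ Tr P + Tr M`, proved with a continuous substitute for the sign function. -/

theorem inner_sqrt_sqrt {A : H →L[ℂ] H} (hA : 0 ≤ A) (x y : H) :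
    ⟪CFC.sqrt A x, CFC.sqrt A y⟫_ℂ = ⟪x, A y⟫_ℂ := by
  have hS : IsSelfAdjoint (CFC.sqrt A) := (CFC.sqrt_nonneg A).isSelfAdjoint
  conv_rhs => rw [← CFC.sqrt_mul_sqrt_self A hA]
  change _ = ⟪x, CFC.sqrt A (CFC.sqrt A y)⟫_ℂ
  rw [← ContinuousLinearMap.adjoint_inner_left _ (CFC.sqrt A y), hS.adjoint_eq]

theorem re_inner_self_apply {A : H →L[ℂ] H} (hA : 0 ≤ A) (x : H) :
    RCLike.re ⟪x, A x⟫_ℂ = ‖CFC.sqrt A x‖ ^ 2 := by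
  rw [← inner_sqrt_sqrt hA, inner_self_eq_norm_sq]

theorem re_inner_self_apply_nonneg {A : H →L[ℂ] H} (hA : 0 ≤ A) (x : H) :
    0 ≤ RCLike.re ⟪x, A x⟫_ℂ := by
  rw [re_inner_self_apply hA]
  positivity

theorem adjoint_sqrt (A : H →L[ℂ] H) :
    ContinuousLinearMap.adjoint (CFC.sqrt A) = CFC.sqrt A :=
  ((CFC.sqrt_nonneg A).isSelfAdjoint).adjoint_eq

theorem posTrace_eq_tsum_norm_sq {A : H →L[ℂ] H} (hA : 0 ≤ A) :
    posTrace A = ∑' i, ENNReal.ofReal (‖CFC.sqrt A (stdBasis H i)‖ ^ 2) := by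
  simp_rw [posTrace, re_inner_self_apply hA]

theorem isTraceClass_iff_of_nonneg {A : H →L[ℂ] H} (hA : 0 ≤ A) :
    IsTraceClass A ↔ posTrace A < ∞ := by
  rw [IsTraceClass, CFC.abs_of_nonneg A hA]

theorem posTrace_add {A B : H →L[ℂ] H} (hA : 0 ≤ A) (hB : 0 ≤ B) :
    posTrace (A + B) = posTrace A + posTrace B := by
  rw [posTrace, posTrace, posTrace, ← ENNReal.tsum_add]
  refine tsum_congr fun i => ?_
  rw [add_apply, inner_add_right, map_add, ENNReal.ofReal_add]
  · exact re_inner_self_apply_nonneg hA _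
  · exact re_inner_self_apply_nonneg hB _

/-- Parseval and Cauchy–Schwarz: the Hilbert–Schmidt norm dominates the operator norm. -/
theorem ofReal_norm_apply_sq_le (S : H →L[ℂ] H) (x : H) :
    ENNReal.ofReal (‖S x‖ ^ 2) ≤ ENNReal.ofReal (‖x‖ ^ 2) *
      ∑' i, ENNReal.ofReal (‖ContinuousLinearMap.adjoint S (stdBasis H i)‖ ^ 2) := by
  rw [ofReal_norm_sq_eq_tsum (stdBasis H), ← ENNReal.tsum_mul_left]
  refine ENNReal.tsum_le_tsum fun i => ?_
  rw [← ENNReal.ofReal_mul (by positivity), ← mul_pow, ← ContinuousLinearMap.adjoint_inner_left]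
  gcongr
  exact (norm_inner_le_norm _ _).trans_eq (mul_comm _ _)

/-- The operator norm of a positive operator is bounded by its trace. -/
theorem ofReal_norm_le_posTrace {A : H →L[ℂ] H} (hA : 0 ≤ A) :
    ENNReal.ofReal ‖A‖ ≤ posTrace A := by
  rcases eq_or_ne (posTrace A) ∞ with h | h
  · simp [h]
  rw [ENNReal.ofReal_le_iff_le_toReal h]
  have hS : ‖CFC.sqrt A‖ ≤ √(posTrace A).toReal := by
    refine ContinuousLinearMap.opNorm_le_bound _ (Real.sqrt_nonneg _) fun x => ?_
    refine le_of_sq_le_sq ?_ (by positivity)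
    have h1 := ofReal_norm_apply_sq_le (CFC.sqrt A) x
    rw [adjoint_sqrt, ← posTrace_eq_tsum_norm_sq hA,
      ENNReal.ofReal_le_iff_le_toReal (ENNReal.mul_ne_top ENNReal.ofReal_ne_top h),
      ENNReal.toReal_mul, ENNReal.toReal_ofReal (by positivity)] at h1
    rw [mul_pow, Real.sq_sqrt ENNReal.toReal_nonneg]
    linarith
  calc ‖A‖ = ‖CFC.sqrt A * CFC.sqrt A‖ := by rw [CFC.sqrt_mul_sqrt_self A hA]
    _ ≤ ‖CFC.sqrt A‖ * ‖CFC.sqrt A‖ := norm_mul_le _ _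
    _ ≤ √(posTrace A).toReal * √(posTrace A).toReal := by gcongr
    _ = _ := Real.mul_self_sqrt ENNReal.toReal_nonneg

/-! ### Hilbert–Schmidt sums and cyclicity of the trace -/

theorem summable_of_tsum_ofReal_lt_top {ι : Type*} {f : ι → ℝ} (hf : ∀ i, 0 ≤ f i)
    (h : ∑' i, ENNReal.ofReal (f i) < ∞) : Summable f := by
  have h1 := ENNReal.summable_toReal h.ne
  exact h1.congr fun i => ENNReal.toReal_ofReal (hf i)

theorem summable_inner_of_hilbertSchmidt {ι : Type*} {f g : ι → H}
    (hf : ∑' i, ENNReal.ofReal (‖f i‖ ^ 2) < ∞) (hg : ∑' i, ENNReal.ofReal (‖g i‖ ^ 2) < ∞) :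
    Summable fun i => ⟪f i, g i⟫_ℂ := by
  have h1 := summable_of_tsum_ofReal_lt_top (fun i => by positivity) hf
  have h2 := summable_of_tsum_ofReal_lt_top (fun i => by positivity) hg
  refine Summable.of_norm_bounded (h1.add h2) fun i => ?_
  refine (norm_inner_le_norm _ _).trans ?_
  nlinarith [sq_nonneg (‖f i‖ - ‖g i‖), sq_nonneg (‖f i‖), sq_nonneg (‖g i‖)]

theorem re_inner_eq_norm_sq_sub (x y : H) :
    RCLike.re ⟪x, y⟫_ℂ = (‖x + y‖ ^ 2 - ‖x - y‖ ^ 2) / 4 := by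
  rw [norm_add_sq (𝕜 := ℂ), norm_sub_sq (𝕜 := ℂ)]
  ring

theorem tsum_norm_sq_add_lt_top {ι : Type*} {f g : ι → H}
    (hf : ∑' i, ENNReal.ofReal (‖f i‖ ^ 2) < ∞) (hg : ∑' i, ENNReal.ofReal (‖g i‖ ^ 2) < ∞) :
    ∑' i, ENNReal.ofReal (‖f i + g i‖ ^ 2) < ∞ := by
  have h : ∑' i, ENNReal.ofReal (‖f i + g i‖ ^ 2) ≤
      2 * (∑' i, ENNReal.ofReal (‖f i‖ ^ 2) + ∑' i, ENNReal.ofReal (‖g i‖ ^ 2)) := by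
    rw [← ENNReal.tsum_add, ← ENNReal.tsum_mul_left]
    refine ENNReal.tsum_le_tsum fun i => ?_
    rw [← ENNReal.ofReal_add (by positivity) (by positivity),
      show (2 : ℝ≥0∞) = ENNReal.ofReal 2 by simp, ← ENNReal.ofReal_mul (by norm_num)]
    refine ENNReal.ofReal_le_ofReal ?_
    have := norm_add_le (f i) (g i)
    have h0 := norm_nonneg (f i + g i)
    nlinarith [sq_nonneg (‖f i‖ - ‖g i‖)]
  exact h.trans_lt (ENNReal.mul_lt_top (by simp) (ENNReal.add_lt_top.2 ⟨hf, hg⟩))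

theorem tsum_norm_sq_real_eq (S : H →L[ℂ] H) :
    ∑' i, ‖S (stdBasis H i)‖ ^ 2
      = ∑' i, ‖ContinuousLinearMap.adjoint S (stdBasis H i)‖ ^ 2 := by
  have h := congrArg ENNReal.toReal (tsum_norm_sq_eq (stdBasis H) (stdBasis H) S)
  rw [ENNReal.tsum_toReal_eq (fun _ => ENNReal.ofReal_ne_top),
    ENNReal.tsum_toReal_eq (fun _ => ENNReal.ofReal_ne_top)] at h
  simpa only [ENNReal.toReal_ofReal (sq_nonneg _)] using h

/-- Real part of the cyclicity of the trace for products of two Hilbert–Schmidt operators. -/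
theorem re_tsum_inner_eq (P Q : H →L[ℂ] H)
    (hP : ∑' i, ENNReal.ofReal (‖P (stdBasis H i)‖ ^ 2) < ∞)
    (hQ : ∑' i, ENNReal.ofReal (‖Q (stdBasis H i)‖ ^ 2) < ∞) :
    RCLike.re (∑' i, ⟪P (stdBasis H i), Q (stdBasis H i)⟫_ℂ) =
      ∑' i, RCLike.re ⟪ContinuousLinearMap.adjoint Q (stdBasis H i),
        ContinuousLinearMap.adjoint P (stdBasis H i)⟫_ℂ := by
  have hQ' : ∑' i, ENNReal.ofReal (‖(-Q) (stdBasis H i)‖ ^ 2) < ∞ := by simpa using hQ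
  have hadd := tsum_norm_sq_add_lt_top hP hQ
  have hsub := tsum_norm_sq_add_lt_top hP hQ'
  have e1 := tsum_norm_sq_real_eq (P + Q)
  have e2 := tsum_norm_sq_real_eq (P + -Q)
  have s1 := summable_of_tsum_ofReal_lt_top (fun i => by positivity) hadd
  have s2 := summable_of_tsum_ofReal_lt_top (fun i => by positivity) hsub
  have t1 : Summable fun i => ‖ContinuousLinearMap.adjoint (P + Q) (stdBasis H i)‖ ^ 2 := by
    refine summable_of_tsum_ofReal_lt_top (fun i => by positivity) ?_
    rw [← tsum_norm_sq_eq (stdBasis H) (stdBasis H)]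
    exact hadd
  have t2 : Summable fun i => ‖ContinuousLinearMap.adjoint (P + -Q) (stdBasis H i)‖ ^ 2 := by
    refine summable_of_tsum_ofReal_lt_top (fun i => by positivity) ?_
    rw [← tsum_norm_sq_eq (stdBasis H) (stdBasis H)]
    exact hsub
  have hre : RCLike.re (∑' i, ⟪P (stdBasis H i), Q (stdBasis H i)⟫_ℂ) =
      ∑' i, RCLike.re ⟪P (stdBasis H i), Q (stdBasis H i)⟫_ℂ :=
    (RCLike.reCLM (K := ℂ)).map_tsum (summable_inner_of_hilbertSchmidt hP hQ)
  -- Polarization expresses both sides through Hilbert–Schmidt norms of `P + Q` and `P - Q`, which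
  -- do not change under the adjoint.
  have key1 : ∀ i, RCLike.re ⟪P (stdBasis H i), Q (stdBasis H i)⟫_ℂ =
      (‖(P + Q) (stdBasis H i)‖ ^ 2 - ‖(P + -Q) (stdBasis H i)‖ ^ 2) / 4 := by
    intro i
    rw [re_inner_eq_norm_sq_sub]
    simp [sub_eq_add_neg]
  have key2 : ∀ i, RCLike.re ⟪ContinuousLinearMap.adjoint Q (stdBasis H i),
        ContinuousLinearMap.adjoint P (stdBasis H i)⟫_ℂ =
      (‖ContinuousLinearMap.adjoint (P + Q) (stdBasis H i)‖ ^ 2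
        - ‖ContinuousLinearMap.adjoint (P + -Q) (stdBasis H i)‖ ^ 2) / 4 := by
    intro i
    rw [← inner_conj_symm, RCLike.conj_re, re_inner_eq_norm_sq_sub]
    simp [sub_eq_add_neg]
  rw [hre]
  simp_rw [key1, key2]
  rw [tsum_div_const, tsum_div_const, Summable.tsum_sub t1 t2, ← e1, ← e2]
  congr 1
  exact Summable.tsum_sub s1 s2

theorem tsum_norm_comp_sq_le (B S : H →L[ℂ] H) :
    ∑' i, ENNReal.ofReal (‖B (S (stdBasis H i))‖ ^ 2) ≤
      ENNReal.ofReal (‖B‖ ^ 2) * ∑' i, ENNReal.ofReal (‖S (stdBasis H i)‖ ^ 2) := by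
  rw [← ENNReal.tsum_mul_left]
  refine ENNReal.tsum_le_tsum fun i => ?_
  rw [← ENNReal.ofReal_mul (by positivity), ← mul_pow]
  gcongr
  exact B.le_opNorm _

/-- The adjoint `B* A^{1/2}` has the same Hilbert–Schmidt norm, and there `B*` acts on the left and
costs only its operator norm. -/
theorem tsum_norm_sq_sqrt_comp_lt_top {A : H →L[ℂ] H} (hA : 0 ≤ A) (hA' : posTrace A < ∞)
    (B : H →L[ℂ] H) : ∑' i, ENNReal.ofReal (‖CFC.sqrt A (B (stdBasis H i))‖ ^ 2) < ∞ := by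
  have h := tsum_norm_sq_eq (stdBasis H) (stdBasis H) (CFC.sqrt A ∘L B)
  simp only [ContinuousLinearMap.adjoint_comp, adjoint_sqrt, ContinuousLinearMap.comp_apply] at h
  rw [h]
  refine (tsum_norm_comp_sq_le _ _).trans_lt (ENNReal.mul_lt_top ENNReal.ofReal_lt_top ?_)
  rwa [← posTrace_eq_tsum_norm_sq hA]

/-- `Tr (B γ) = Tr (γ^{1/2} B γ^{1/2})`. -/
theorem ofReal_re_trace_comp {B γ : H →L[ℂ] H} (hB : 0 ≤ B) (hγ : 0 ≤ γ)
    (hγ' : posTrace γ < ∞) :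
    ENNReal.ofReal (RCLike.re (trace (B ∘L γ))) =
      ∑' i, ENNReal.ofReal
        (RCLike.re ⟪CFC.sqrt γ (stdBasis H i), B (CFC.sqrt γ (stdBasis H i))⟫_ℂ) := by
  have hBa : ContinuousLinearMap.adjoint B = B := hB.isSelfAdjoint.adjoint_eq
  have hP := tsum_norm_sq_sqrt_comp_lt_top hγ hγ' B
  have hQ : ∑' i, ENNReal.ofReal (‖CFC.sqrt γ (stdBasis H i)‖ ^ 2) < ∞ := by
    rwa [← posTrace_eq_tsum_norm_sq hγ]
  have h := re_tsum_inner_eq (CFC.sqrt γ ∘L B) (CFC.sqrt γ) hP hQ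
  have h1 : trace (B ∘L γ) =
      ∑' i, ⟪(CFC.sqrt γ ∘L B) (stdBasis H i), CFC.sqrt γ (stdBasis H i)⟫_ℂ := by
    refine tsum_congr fun i => ?_
    change ⟪_, B (γ _)⟫_ℂ = ⟪CFC.sqrt γ (B _), _⟫_ℂ
    rw [inner_sqrt_sqrt hγ, ← ContinuousLinearMap.adjoint_inner_left, hBa]
  rw [h1, h, ContinuousLinearMap.adjoint_comp, adjoint_sqrt, hBa]
  have hpos : ∀ i, 0 ≤ RCLike.re
      ⟪CFC.sqrt γ (stdBasis H i), B (CFC.sqrt γ (stdBasis H i))⟫_ℂ :=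
    fun i => re_inner_self_apply_nonneg hB _
  have hfin : ∑' i, ENNReal.ofReal (RCLike.re
      ⟪CFC.sqrt γ (stdBasis H i), B (CFC.sqrt γ (stdBasis H i))⟫_ℂ) < ∞ := by
    simp_rw [re_inner_self_apply hB]
    exact (tsum_norm_comp_sq_le _ _).trans_lt (ENNReal.mul_lt_top ENNReal.ofReal_lt_top hQ)
  exact ENNReal.ofReal_tsum_of_nonneg hpos (summable_of_tsum_ofReal_lt_top hpos hfin)

/-- `Tr (B γ) = Tr (B^{1/2} γ B^{1/2})`. -/
theorem ofReal_re_trace_comp' {B γ : H →L[ℂ] H} (hB : 0 ≤ B) (hγ : 0 ≤ γ)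
    (hγ' : posTrace γ < ∞) :
    ENNReal.ofReal (RCLike.re (trace (B ∘L γ))) =
      ∑' i, ENNReal.ofReal
        (RCLike.re ⟪CFC.sqrt B (stdBasis H i), γ (CFC.sqrt B (stdBasis H i))⟫_ℂ) := by
  rw [ofReal_re_trace_comp hB hγ hγ']
  simp_rw [re_inner_self_apply hB, re_inner_self_apply hγ]
  have h := tsum_norm_sq_eq (stdBasis H) (stdBasis H) (CFC.sqrt B ∘L CFC.sqrt γ)
  simpa only [ContinuousLinearMap.adjoint_comp, adjoint_sqrt, ContinuousLinearMap.comp_apply]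
    using h

/-! ### Trace class of differences of positive operators -/

/-- Split `P` into two square roots and use `2ab ≤ a² + b²`. Both resulting sums are at most `Tr P`,
the second because `P^{1/2} C` and its adjoint `C P^{1/2}` have equal Hilbert–Schmidt norms. -/
theorem ofReal_sum_abs_re_inner_comp_le {P C : H →L[ℂ] H} (hP : 0 ≤ P) (hC : IsSelfAdjoint C)
    (hC' : ‖C‖ ≤ 1) (F : Finset (basisIndex H)) :
    ENNReal.ofReal (∑ i ∈ F, |RCLike.re ⟪stdBasis H i, P (C (stdBasis H i))⟫_ℂ|) ≤ posTrace P := by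
  have h2 : ∑' i, ENNReal.ofReal (‖CFC.sqrt P (C (stdBasis H i))‖ ^ 2) ≤ posTrace P := by
    have h := tsum_norm_sq_eq (stdBasis H) (stdBasis H) (CFC.sqrt P ∘L C)
    simp only [ContinuousLinearMap.adjoint_comp, adjoint_sqrt, hC.adjoint_eq,
      ContinuousLinearMap.comp_apply] at h
    refine h.le.trans ((tsum_norm_comp_sq_le _ _).trans ?_)
    rw [← posTrace_eq_tsum_norm_sq hP]
    refine mul_le_of_le_one_left zero_le ?_
    rw [ENNReal.ofReal_le_one]
    exact pow_le_one₀ (norm_nonneg _) hC'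
  have h1 := (posTrace_eq_tsum_norm_sq hP).symm.le
  have h3 : ENNReal.ofReal (∑ i ∈ F, |RCLike.re ⟪stdBasis H i, P (C (stdBasis H i))⟫_ℂ|) * 2 ≤
      posTrace P * 2 := by
    rw [mul_two (posTrace P), show (2 : ℝ≥0∞) = ENNReal.ofReal 2 by simp,
      ← ENNReal.ofReal_mul (by positivity), Finset.sum_mul,
      ENNReal.ofReal_sum_of_nonneg (fun i _ => by positivity)]
    refine le_trans ?_ (add_le_add h1 h2)
    rw [← ENNReal.tsum_add]
    refine le_trans (Finset.sum_le_sum fun i _ => ?_) (ENNReal.sum_le_tsum F)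
    rw [← ENNReal.ofReal_add (by positivity) (by positivity), ← inner_sqrt_sqrt hP]
    refine ENNReal.ofReal_le_ofReal ?_
    have h4 := (RCLike.abs_re_le_norm ⟪CFC.sqrt P (stdBasis H i),
      CFC.sqrt P (C (stdBasis H i))⟫_ℂ).trans (norm_inner_le_norm _ _)
    nlinarith [sq_nonneg (‖CFC.sqrt P (stdBasis H i)‖ - ‖CFC.sqrt P (C (stdBasis H i))‖)]
  exact (ENNReal.mul_le_mul_iff_left (by simp) (by simp)).1 h3

/-- The sign function is not continuous, so `x / (|x| + δ)` replaces it in the functional calculus;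
the error is bounded by `δ` since `(|x| - δ)(|x| + δ) ≤ x²`. -/
theorem exists_contraction_mul_near_abs {A : H →L[ℂ] H} (hA : IsSelfAdjoint A) {δ : ℝ}
    (hδ : 0 < δ) : ∃ C : H →L[ℂ] H, IsSelfAdjoint C ∧ ‖C‖ ≤ 1 ∧
      CFC.abs A ≤ A * C + algebraMap ℝ (H →L[ℂ] H) δ := by
  have hpos : ∀ x : ℝ, 0 < |x| + δ := fun x => by positivity
  have hc : Continuous fun x : ℝ => x / (|x| + δ) :=
    continuous_id.div (by fun_prop) fun x => (hpos x).ne'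
  refine ⟨cfc (fun x : ℝ => x / (|x| + δ)) A, cfc_predicate _ _, ?_, ?_⟩
  · refine norm_cfc_le zero_le_one fun x _ => ?_
    rw [norm_div, Real.norm_eq_abs, Real.norm_of_nonneg (hpos x).le, div_le_one (hpos x)]
    linarith
  · have h1 : A * cfc (fun x : ℝ => x / (|x| + δ)) A + algebraMap ℝ (H →L[ℂ] H) δ =
        cfc (fun x : ℝ => x * (x / (|x| + δ)) + δ) A := by
      rw [cfc_add_const δ (fun x : ℝ => x * (x / (|x| + δ))) A (continuous_id.mul hc).continuousOn,
        cfc_mul (fun x : ℝ => x) _ A continuousOn_id hc.continuousOn, cfc_id' ℝ A]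
    rw [h1, CFC.abs_eq_cfc_norm A hA]
    refine cfc_mono (fun x _ => ?_) continuous_norm.continuousOn
      ((continuous_id.mul hc).add continuous_const).continuousOn
    rw [Real.norm_eq_abs, mul_div_assoc', ← sub_le_iff_le_add, le_div_iff₀ (hpos x)]
    nlinarith [sq_abs x, sq_nonneg δ]

/-- `Tr |P - M| ≤ Tr P + Tr M` for positive operators. -/
theorem posTrace_abs_sub_le {P M : H →L[ℂ] H} (hP : 0 ≤ P) (hM : 0 ≤ M) :
    posTrace (CFC.abs (P - M)) ≤ posTrace P + posTrace M := by
  have hA : IsSelfAdjoint (P - M) := hP.isSelfAdjoint.sub hM.isSelfAdjoint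
  obtain ⟨R, hR⟩ : ∃ R, R = CFC.abs (P - M) := ⟨_, rfl⟩
  have hR0 : 0 ≤ R := hR ▸ CFC.abs_nonneg (P - M)
  rw [← hR, posTrace, ENNReal.tsum_eq_iSup_sum]
  refine iSup_le fun F => ENNReal.le_of_forall_pos_le_add fun ε hε _ => ?_
  -- Each basis vector in `F` costs one error `δ`, so the total stays below `ε`; the `+ 1` covers
  -- empty `F`.
  have hδ : (0 : ℝ) < ε / (F.card + 1) := by positivity
  obtain ⟨C, hC, hC', hle⟩ := exists_contraction_mul_near_abs hA hδ
  rw [← hR] at hle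
  have hpos : ∀ i, 0 ≤ RCLike.re ⟪stdBasis H i, R (stdBasis H i)⟫_ℂ := by
    intro i
    exact re_inner_self_apply_nonneg hR0 _
  have hterm : ∀ i, RCLike.re ⟪stdBasis H i, R (stdBasis H i)⟫_ℂ ≤
      |RCLike.re ⟪stdBasis H i, P (C (stdBasis H i))⟫_ℂ| +
      |RCLike.re ⟪stdBasis H i, M (C (stdBasis H i))⟫_ℂ| + ε / (F.card + 1) := by
    intro i
    have h1 := re_inner_self_apply_nonneg (sub_nonneg.2 hle) (stdBasis H i)
    have h2 : ((P - M) * C + algebraMap ℝ (H →L[ℂ] H) (ε / (F.card + 1)) - R)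
        (stdBasis H i) = P (C (stdBasis H i)) - M (C (stdBasis H i)) +
          ((ε / (F.card + 1) : ℝ) : ℂ) • stdBasis H i - R (stdBasis H i) := rfl
    rw [h2, inner_sub_right, inner_add_right, inner_sub_right, inner_smul_right,
      inner_self_eq_norm_sq_to_K, (stdBasis H).orthonormal.1 i] at h1
    simp only [map_sub, map_add, RCLike.ofReal_one, one_pow, mul_one, RCLike.re_to_complex,
      Complex.ofReal_re] at h1 ⊢
    have h4 := le_abs_self (⟪stdBasis H i, P (C (stdBasis H i))⟫_ℂ).re
    have h5 := neg_abs_le (⟪stdBasis H i, M (C (stdBasis H i))⟫_ℂ).re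
    linarith
  have hFε : ∑ _i ∈ F, (ε / (F.card + 1) : ℝ) ≤ ε := by
    rw [Finset.sum_const, nsmul_eq_mul, mul_div_assoc', div_le_iff₀ (by positivity)]
    nlinarith [ε.coe_nonneg]
  rw [← ENNReal.ofReal_sum_of_nonneg fun i _ => hpos i]
  refine (ENNReal.ofReal_le_ofReal (Finset.sum_le_sum fun i _ => hterm i)).trans ?_
  rw [Finset.sum_add_distrib, Finset.sum_add_distrib]
  refine ENNReal.ofReal_add_le.trans (add_le_add (ENNReal.ofReal_add_le.trans (add_le_add
    (ofReal_sum_abs_re_inner_comp_le hP hC hC' F) (ofReal_sum_abs_re_inner_comp_le hM hC hC' F))) ?_)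
  exact (ENNReal.ofReal_le_ofReal hFε).trans_eq ENNReal.ofReal_coe_nnreal

theorem IsTraceClass.sub {P M : H →L[ℂ] H} (hP : 0 ≤ P) (hM : 0 ≤ M) (hP' : IsTraceClass P)
    (hM' : IsTraceClass M) : IsTraceClass (P - M) := by
  rw [isTraceClass_iff_of_nonneg ‹_›] at hP' hM'
  exact (posTrace_abs_sub_le hP hM).trans_lt (ENNReal.add_lt_top.2 ⟨hP', hM'⟩)

/-! ### Weak operator convergence -/

/-- By Parseval, tracing against rank-one operators recovers all matrix elements; hence weak-*
convergence implies weak operator convergence. -/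
theorem trace_rankOne_comp (x y : H) (D : H →L[ℂ] H) :
    trace (InnerProductSpace.rankOne ℂ y x ∘L D) = ⟪x, D y⟫_ℂ := by
  rw [← ContinuousLinearMap.adjoint_inner_left,
    ← ((stdBasis H).hasSum_inner_mul_inner (ContinuousLinearMap.adjoint D x) y).tsum_eq]
  refine tsum_congr fun i => ?_
  rw [ContinuousLinearMap.comp_apply, InnerProductSpace.rankOne_apply, inner_smul_right,
    ContinuousLinearMap.adjoint_inner_left]

theorem isCompactOperator_rankOne (x y : H) :
    IsCompactOperator (InnerProductSpace.rankOne ℂ y x) := by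
  have h : IsCompactOperator (ContinuousLinearMap.toSpanSingleton ℂ y) :=
    isCompactOperator_of_locallyCompactSpace_rng _
  exact h.comp_clm (innerSL ℂ x)

/-- Bounded families of operators have limits along ultrafilters in the weak operator topology. -/
theorem exists_tendsto_inner_of_bounded {ι : Type*} (U : Ultrafilter ι) {A : ι → H →L[ℂ] H}
    {C : ℝ} (hA : ∀ᶠ i in U, ‖A i‖ ≤ C) :
    ∃ B : H →L[ℂ] H, ∀ x y, Tendsto (fun i => ⟪x, A i y⟫_ℂ) U (𝓝 ⟪x, B y⟫_ℂ) := by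
  have hb : ∀ x y, ∀ᶠ i in U, ‖⟪A i x, y⟫_ℂ‖ ≤ C * ‖x‖ * ‖y‖ := by
    intro x y
    filter_upwards [hA] with i hi
    refine (norm_inner_le_norm _ _).trans ?_
    gcongr
    exact ((A i).le_opNorm x).trans (by gcongr)
  have hlim : ∀ x y, ∃ z ∈ Metric.closedBall (0 : ℂ) (C * ‖x‖ * ‖y‖),
      Tendsto (fun i => ⟪A i x, y⟫_ℂ) U (𝓝 z) := by
    intro x y
    refine (isCompact_closedBall (0 : ℂ) (C * ‖x‖ * ‖y‖)).ultrafilter_le_nhds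
      (U.map fun i => ⟪A i x, y⟫_ℂ) ?_
    rw [le_principal_iff, Ultrafilter.coe_map, mem_map]
    filter_upwards [hb x y] with i hi
    simpa using hi
  choose L hL hLt using hlim
  -- Uniqueness of limits makes the limit form sesquilinear; its bound `C` then lets the Riesz
  -- representation produce an operator.
  let B : H →L⋆[ℂ] H →L[ℂ] ℂ := LinearMap.mkContinuous₂
    (LinearMap.mk₂'ₛₗ (starRingEnd ℂ) (RingHom.id ℂ) L
      (fun x x' y => tendsto_nhds_unique (hLt _ _) <| by
        simpa [inner_add_left] using (hLt x y).add (hLt x' y))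
      (fun c x y => tendsto_nhds_unique (hLt _ _) <| by
        simpa [inner_smul_left, mul_comm] using (hLt x y).const_mul (starRingEnd ℂ c))
      (fun x y y' => tendsto_nhds_unique (hLt _ _) <| by
        simpa [inner_add_right] using (hLt x y).add (hLt x y'))
      (fun c x y => tendsto_nhds_unique (hLt _ _) <| by
        simpa [inner_smul_right] using (hLt x y).const_mul c)) C
    (fun x y => by simpa using hL x y)
  refine ⟨InnerProductSpace.continuousLinearMapOfBilin B, fun x y => ?_⟩
  have h1 : ⟪InnerProductSpace.continuousLinearMapOfBilin B y, x⟫_ℂ = L y x :=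
    InnerProductSpace.continuousLinearMapOfBilin_apply B y x
  have h2 := (Complex.continuous_conj.tendsto _).comp (hLt y x)
  rw [← h1] at h2
  simpa only [Function.comp_def, inner_conj_symm] using h2

theorem isPositive_of_tendsto_inner {ι : Type*} {F : Filter ι} [F.NeBot] {A : ι → H →L[ℂ] H}
    {B : H →L[ℂ] H} (hA : ∀ᶠ i in F, (A i).IsPositive)
    (h : ∀ x y, Tendsto (fun i => ⟪x, A i y⟫_ℂ) F (𝓝 ⟪x, B y⟫_ℂ)) : B.IsPositive := by
  rw [ContinuousLinearMap.isPositive_def]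
  refine ⟨fun x y => ?_, fun x => ?_⟩
  · have h1 := (Complex.continuous_conj.tendsto _).comp (h y x)
    rw [inner_conj_symm] at h1
    refine tendsto_nhds_unique (h1.congr' ?_) (h x y)
    filter_upwards [hA] with i hi
    rw [Function.comp_apply, inner_conj_symm]
    exact hi.isSymmetric x y
  · have h1 := (Complex.continuous_re.tendsto _).comp (h x x)
    have h2 : B.reApplyInnerSelf x = (⟪x, B x⟫_ℂ).re := by
      rw [ContinuousLinearMap.reApplyInnerSelf_apply, inner_re_symm, RCLike.re_to_complex]
    rw [h2]
    refine ge_of_tendsto h1 ?_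
    filter_upwards [hA] with i hi
    exact hi.re_inner_nonneg_right x

end Trace

section Unbounded

variable {H : Type*} [NormedAddCommGroup H] [InnerProductSpace ℂ H] [CompleteSpace H]

/-! ### The regularized operators as quadratic forms -/

theorem IsPositiveOp.isFormalAdjoint {T : H →ₗ.[ℂ] H} (hT : IsPositiveOp T) :
    T.IsFormalAdjoint T := by
  have h := LinearPMap.adjoint_isFormalAdjoint hT.selfAdjoint.dense_domain
  rwa [LinearPMap.isSelfAdjoint_def.mp hT.selfAdjoint] at h

theorem exists_regularization_eq {T : H →ₗ.[ℂ] H} (hT : IsPositiveOp T) {ε : ℝ} (hε : 0 < ε)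
    (φ : H) : ∃ ψ : T.domain, (ψ : H) + (ε : ℂ) • T ψ = φ ∧ regularization T ε φ = T ψ := by
  have h := isRegularization_regularization hT hε
  obtain ⟨ψ, rfl⟩ := h.1.2 φ
  exact ⟨ψ, rfl, h.2 ψ⟩

theorem re_inner_add_smul_apply (T : H →ₗ.[ℂ] H) (ε : ℝ) (ψ : T.domain) :
    RCLike.re ⟪(ψ : H) + (ε : ℂ) • T ψ, T ψ⟫_ℂ =
      RCLike.re ⟪(ψ : H), T ψ⟫_ℂ + ε * ‖T ψ‖ ^ 2 := by
  rw [inner_add_left, inner_smul_left, Complex.conj_ofReal, inner_self_eq_norm_sq_to_K, map_add]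
  simp only [RCLike.re_to_complex, Complex.re_ofReal_mul]
  norm_cast

theorem regularization_nonneg {T : H →ₗ.[ℂ] H} (hT : IsPositiveOp T) {ε : ℝ} (hε : 0 < ε) :
    0 ≤ regularization T ε := by
  rw [ContinuousLinearMap.nonneg_iff_isPositive, ContinuousLinearMap.isPositive_def]
  refine ⟨fun x y => ?_, fun x => ?_⟩
  · obtain ⟨ψ, rfl, hψ⟩ := exists_regularization_eq hT hε x
    obtain ⟨χ, rfl, hχ⟩ := exists_regularization_eq hT hε y
    change ⟪regularization T ε _, _⟫_ℂ = ⟪_, regularization T ε _⟫_ℂ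
    rw [hψ, hχ, inner_add_left, inner_add_right, inner_smul_left, inner_smul_right,
      Complex.conj_ofReal, hT.isFormalAdjoint ψ χ]
  · obtain ⟨ψ, rfl, hψ⟩ := exists_regularization_eq hT hε x
    rw [ContinuousLinearMap.reApplyInnerSelf_apply, hψ, inner_re_symm, re_inner_add_smul_apply]
    have := hT.nonneg ψ
    positivity

/-- The form of `T (1 + ε T)⁻¹` is the Moreau–Yosida envelope of the form of `T`. -/
theorem re_inner_regularization_le {T : H →ₗ.[ℂ] H} (hT : IsPositiveOp T) {ε : ℝ} (hε : 0 < ε)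
    (φ : H) (ψ : T.domain) :
    RCLike.re ⟪φ, regularization T ε φ⟫_ℂ ≤
      RCLike.re ⟪(ψ : H), T ψ⟫_ℂ + ε⁻¹ * ‖φ - ψ‖ ^ 2 := by
  obtain ⟨χ, rfl, hχ⟩ := exists_regularization_eq hT hε φ
  -- Expand around the minimiser `χ = (1 + εT)⁻¹ φ`. By symmetry of `T` the terms linear in `h`
  -- cancel, leaving `⟨h, T h⟩ + ε⁻¹ ‖h‖² ≥ 0`.
  obtain ⟨h, rfl⟩ : ∃ h, ψ = χ + h := ⟨ψ - χ, by abel⟩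
  rw [hχ, re_inner_add_smul_apply]
  have h1 : (χ : H) + (ε : ℂ) • T χ - ((χ + h : T.domain) : H) = (ε : ℂ) • T χ - (h : H) := by
    rw [Submodule.coe_add]
    abel
  have h2 : ⟪(χ : H), T h⟫_ℂ = ⟪T χ, (h : H)⟫_ℂ := (hT.isFormalAdjoint χ h).symm
  have h3 : RCLike.re ⟪(h : H), T χ⟫_ℂ = RCLike.re ⟪T χ, (h : H)⟫_ℂ := inner_re_symm _ _
  rw [h1, norm_sub_sq (𝕜 := ℂ), norm_smul, inner_smul_left, Complex.conj_ofReal, T.map_add,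
    Submodule.coe_add, inner_add_left, inner_add_right, inner_add_right, h2, Complex.norm_real,
    Real.norm_of_nonneg hε.le]
  simp only [map_add, RCLike.re_to_complex, Complex.re_ofReal_mul] at h3 ⊢
  have h4 := hT.nonneg h
  rw [RCLike.re_to_complex] at h4
  rw [h3]
  have h5 : ε⁻¹ * ((ε * ‖T χ‖) ^ 2 - 2 * (ε * (⟪T χ, (h : H)⟫_ℂ).re) + ‖(h : H)‖ ^ 2) =
      ε * ‖T χ‖ ^ 2 - 2 * (⟪T χ, (h : H)⟫_ℂ).re + ε⁻¹ * ‖(h : H)‖ ^ 2 := by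
    field_simp
  rw [h5]
  have h6 : 0 ≤ ε⁻¹ * ‖(h : H)‖ ^ 2 := by positivity
  linarith

/-- The envelope is attained at `ψ = (1 + εT)⁻¹ φ`, because `φ - ψ = ε T ψ`. Inserting this
minimiser into the envelope of another operator compares the two regularizations. -/
theorem exists_re_inner_regularization_eq {T : H →ₗ.[ℂ] H} (hT : IsPositiveOp T) {ε : ℝ}
    (hε : 0 < ε) (φ : H) : ∃ ψ : T.domain, RCLike.re ⟪φ, regularization T ε φ⟫_ℂ =
      RCLike.re ⟪(ψ : H), T ψ⟫_ℂ + ε⁻¹ * ‖φ - ψ‖ ^ 2 ∧ ‖(ψ : H)‖ ≤ ‖φ‖ := by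
  obtain ⟨ψ, rfl, hψ⟩ := exists_regularization_eq hT hε φ
  refine ⟨ψ, ?_, ?_⟩
  · rw [hψ, re_inner_add_smul_apply, add_sub_cancel_left, norm_smul, Complex.norm_real,
      Real.norm_of_nonneg hε.le]
    field_simp
  · refine le_of_sq_le_sq ((le_add_of_nonneg_right ?_).trans (sq_bound hT hε ψ)) (norm_nonneg _)
    positivity

theorem re_inner_oneAdd (T : H →ₗ.[ℂ] H) (ψ : T.domain) :
    RCLike.re ⟪(ψ : H), oneAdd T ψ⟫_ℂ = ‖(ψ : H)‖ ^ 2 + RCLike.re ⟪(ψ : H), T ψ⟫_ℂ := by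
  change RCLike.re ⟪(ψ : H), (ψ : H) + T ψ⟫_ℂ = _
  rw [inner_add_right, map_add, inner_self_eq_norm_sq]

theorem re_inner_regularization_le_oneAdd {T : H →ₗ.[ℂ] H} (hT : IsPositiveOp T) {ε : ℝ}
    (hε : 0 < ε) (φ : H) :
    RCLike.re ⟪φ, regularization T ε φ⟫_ℂ ≤ RCLike.re ⟪φ, regularization (oneAdd T) ε φ⟫_ℂ := by
  obtain ⟨ψ, hψ, -⟩ := exists_re_inner_regularization_eq hT.oneAdd hε φ
  have h := re_inner_regularization_le hT hε φ ψ
  have h1 : RCLike.re ⟪(ψ : H), oneAdd T ψ⟫_ℂ = _ := re_inner_oneAdd T ψ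
  rw [hψ, h1]
  linarith [sq_nonneg ‖(ψ : H)‖]

theorem re_inner_regularization_oneAdd_le {T : H →ₗ.[ℂ] H} (hT : IsPositiveOp T) {ε : ℝ}
    (hε : 0 < ε) (φ : H) :
    RCLike.re ⟪φ, regularization (oneAdd T) ε φ⟫_ℂ ≤
      RCLike.re ⟪φ, regularization T ε φ⟫_ℂ + ‖φ‖ ^ 2 := by
  obtain ⟨ψ, hψ, hn⟩ := exists_re_inner_regularization_eq hT hε φ
  have h := re_inner_regularization_le hT.oneAdd hε φ ψ
  have h1 : ‖(ψ : H)‖ ^ 2 ≤ ‖φ‖ ^ 2 := by gcongr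
  rw [re_inner_oneAdd] at h
  linarith

/-- At `ε = 1` the envelope is at least `‖ψ‖² + ‖φ - ψ‖²`, and the factor 2 comes from `(a + b)² ≤ 2
(a² + b²)`. -/
theorem norm_sq_le_re_inner_regularization_oneAdd {T : H →ₗ.[ℂ] H} (hT : IsPositiveOp T) (φ : H) :
    ‖φ‖ ^ 2 ≤ 2 * RCLike.re ⟪φ, regularization (oneAdd T) 1 φ⟫_ℂ := by
  obtain ⟨ψ, hψ, -⟩ := exists_re_inner_regularization_eq hT.oneAdd one_pos φ
  have h0 : RCLike.re ⟪(ψ : H), oneAdd T ψ⟫_ℂ = _ := re_inner_oneAdd T ψ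
  rw [hψ, h0]
  have h1 := hT.nonneg ψ
  have h2 := norm_add_le (ψ : H) (φ - ψ)
  rw [add_sub_cancel] at h2
  have h3 := norm_nonneg φ
  nlinarith [sq_nonneg (‖(ψ : H)‖ - ‖φ - ψ‖)]

/-! ### The energy `Tr (T γ)` -/

theorem energyTrace_le_energyTrace_oneAdd {T : H →ₗ.[ℂ] H} (hT : IsPositiveOp T) {γ : H →L[ℂ] H}
    (hγ : 0 ≤ γ) (hγ' : posTrace γ < ∞) : energyTrace T γ ≤ energyTrace (oneAdd T) γ := by
  refine iSup₂_mono fun ε hε => ?_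
  rw [ofReal_re_trace_comp (regularization_nonneg hT hε) hγ hγ',
    ofReal_re_trace_comp (regularization_nonneg hT.oneAdd hε) hγ hγ']
  exact ENNReal.tsum_le_tsum fun i =>
    ENNReal.ofReal_le_ofReal (re_inner_regularization_le_oneAdd hT hε _)

theorem energyTrace_oneAdd_le {T : H →ₗ.[ℂ] H} (hT : IsPositiveOp T) {γ : H →L[ℂ] H}
    (hγ : 0 ≤ γ) (hγ' : posTrace γ < ∞) :
    energyTrace (oneAdd T) γ ≤ energyTrace T γ + posTrace γ := by
  refine iSup₂_le fun ε hε => ?_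
  refine le_trans ?_ (add_le_add_left (le_iSup₂ (f := fun (ε : ℝ) (_ : 0 < ε) =>
    ENNReal.ofReal (RCLike.re (trace (regularization T ε ∘L γ)))) ε hε) _)
  rw [ofReal_re_trace_comp (regularization_nonneg hT hε) hγ hγ',
    ofReal_re_trace_comp (regularization_nonneg hT.oneAdd hε) hγ hγ',
    posTrace_eq_tsum_norm_sq hγ, ← ENNReal.tsum_add]
  refine ENNReal.tsum_le_tsum fun i => ?_
  rw [← ENNReal.ofReal_add (re_inner_self_apply_nonneg (regularization_nonneg hT hε) _)
    (by positivity)]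
  exact ENNReal.ofReal_le_ofReal (re_inner_regularization_oneAdd_le hT hε _)

theorem posTrace_le_two_mul_energyTrace_oneAdd {T : H →ₗ.[ℂ] H} (hT : IsPositiveOp T)
    {γ : H →L[ℂ] H} (hγ : 0 ≤ γ) (hγ' : posTrace γ < ∞) :
    posTrace γ ≤ 2 * energyTrace (oneAdd T) γ := by
  refine le_trans ?_ (mul_le_mul_right (le_iSup₂ (f := fun (ε : ℝ) (_ : 0 < ε) =>
    ENNReal.ofReal (RCLike.re (trace (regularization (oneAdd T) ε ∘L γ)))) 1 one_pos) _)
  rw [ofReal_re_trace_comp (regularization_nonneg hT.oneAdd one_pos) hγ hγ',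
    posTrace_eq_tsum_norm_sq hγ, ← ENNReal.tsum_mul_left]
  refine ENNReal.tsum_le_tsum fun i => ?_
  rw [show (2 : ℝ≥0∞) = ENNReal.ofReal 2 by simp, ← ENNReal.ofReal_mul (by norm_num)]
  exact ENNReal.ofReal_le_ofReal (norm_sq_le_re_inner_regularization_oneAdd hT _)

/-- With the square roots on the regularization, each `Tr (T_ε γ)` is visibly additive in `γ`; a
supremum of sums is at most the sum of suprema. -/
theorem energyTrace_add_le {T : H →ₗ.[ℂ] H} (hT : IsPositiveOp T) {γ₁ γ₂ : H →L[ℂ] H}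
    (h₁ : 0 ≤ γ₁) (h₁' : posTrace γ₁ < ∞) (h₂ : 0 ≤ γ₂) (h₂' : posTrace γ₂ < ∞) :
    energyTrace T (γ₁ + γ₂) ≤ energyTrace T γ₁ + energyTrace T γ₂ := by
  refine iSup₂_le fun ε hε => ?_
  have hB := regularization_nonneg hT hε
  have h : posTrace (γ₁ + γ₂) < ∞ := by
    rw [posTrace_add h₁ h₂]
    exact ENNReal.add_lt_top.2 ⟨h₁', h₂'⟩
  refine le_trans ?_ (add_le_add
    (le_iSup₂ (f := fun (ε : ℝ) (_ : 0 < ε) =>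
      ENNReal.ofReal (RCLike.re (trace (regularization T ε ∘L γ₁)))) ε hε)
    (le_iSup₂ (f := fun (ε : ℝ) (_ : 0 < ε) =>
      ENNReal.ofReal (RCLike.re (trace (regularization T ε ∘L γ₂)))) ε hε))
  rw [ofReal_re_trace_comp' hB (add_nonneg h₁ h₂) h, ofReal_re_trace_comp' hB h₁ h₁',
    ofReal_re_trace_comp' hB h₂ h₂', ← ENNReal.tsum_add]
  refine ENNReal.tsum_le_tsum fun i => ?_
  rw [add_apply, inner_add_right, map_add]
  exact ENNReal.ofReal_add_le

theorem energyTrace_smul (T : H →ₗ.[ℂ] H) {c : ℝ} (hc : 0 ≤ c) (γ : H →L[ℂ] H) :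
    energyTrace T (c • γ) = ENNReal.ofReal c * energyTrace T γ := by
  simp_rw [energyTrace, ENNReal.mul_iSup]
  refine iSup_congr fun ε => iSup_congr fun _ => ?_
  have h : trace (regularization T ε ∘L (c • γ)) = (c : ℂ) * trace (regularization T ε ∘L γ) := by
    rw [trace, trace, ← tsum_mul_left]
    refine tsum_congr fun i => ?_
    rw [← inner_smul_right]
    congr 1
    exact (regularization T ε).map_smul (c : ℂ) (γ _)
  rw [h, RCLike.re_to_complex, Complex.re_ofReal_mul, ENNReal.ofReal_mul hc]
  rfl

theorem posTrace_smul {c : ℝ} (hc : 0 ≤ c) (γ : H →L[ℂ] H) :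
    posTrace (c • γ) = ENNReal.ofReal c * posTrace γ := by
  rw [posTrace, posTrace, ← ENNReal.tsum_mul_left]
  refine tsum_congr fun i => ?_
  rw [← ENNReal.ofReal_mul hc]
  congr 1
  have h : (c • γ) (stdBasis H i) = (c : ℂ) • γ (stdBasis H i) := rfl
  rw [h, inner_smul_right, RCLike.re_to_complex, Complex.re_ofReal_mul, RCLike.re_to_complex]

/-- A Fatou argument: finite partial sums pass to the limit, and each is dominated by the full sum.
-/
theorem tsum_re_inner_le_of_tendsto {ι κ : Type*} {F : Filter ι} [F.NeBot] {A : ι → H →L[ℂ] H}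
    {B : H →L[ℂ] H} (h : ∀ x y, Tendsto (fun i => ⟪x, A i y⟫_ℂ) F (𝓝 ⟪x, B y⟫_ℂ))
    (f : κ → H) {C : ℝ≥0∞}
    (hA : ∀ᶠ i in F, ∑' k, ENNReal.ofReal (RCLike.re ⟪f k, A i (f k)⟫_ℂ) ≤ C) :
    ∑' k, ENNReal.ofReal (RCLike.re ⟪f k, B (f k)⟫_ℂ) ≤ C := by
  rw [ENNReal.tsum_eq_iSup_sum]
  refine iSup_le fun S => ?_
  have ht : Tendsto (fun i => ∑ k ∈ S, ENNReal.ofReal (RCLike.re ⟪f k, A i (f k)⟫_ℂ)) F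
      (𝓝 (∑ k ∈ S, ENNReal.ofReal (RCLike.re ⟪f k, B (f k)⟫_ℂ))) :=
    tendsto_finsetSum S fun k _ =>
      ENNReal.tendsto_ofReal ((Complex.continuous_re.tendsto _).comp (h (f k) (f k)))
  refine le_of_tendsto ht ?_
  filter_upwards [hA] with i hi
  exact (ENNReal.sum_le_tsum S).trans hi

/-- Lower semicontinuity of the energy under weak operator convergence. -/
theorem energyTrace_le_of_tendsto {ι : Type*} {F : Filter ι} [F.NeBot] {T : H →ₗ.[ℂ] H}
    (hT : IsPositiveOp T) {A : ι → H →L[ℂ] H} {B : H →L[ℂ] H}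
    (h : ∀ x y, Tendsto (fun i => ⟪x, A i y⟫_ℂ) F (𝓝 ⟪x, B y⟫_ℂ))
    (hA : ∀ᶠ i in F, 0 ≤ A i ∧ posTrace (A i) < ∞) (hB : 0 ≤ B) (hB' : posTrace B < ∞)
    {C : ℝ≥0∞} (hC : ∀ᶠ i in F, energyTrace T (A i) ≤ C) : energyTrace T B ≤ C := by
  refine iSup₂_le fun ε hε => ?_
  have hR := regularization_nonneg hT hε
  -- In this form the test vectors `T_ε^{1/2} e_k` do not depend on `i`.
  rw [ofReal_re_trace_comp' hR hB hB']
  refine tsum_re_inner_le_of_tendsto h _ ?_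
  filter_upwards [hA, hC] with i hi hi'
  rw [← ofReal_re_trace_comp' hR hi.1 hi.2]
  exact (le_iSup₂ (f := fun (ε : ℝ) (_ : 0 < ε) =>
      ENNReal.ofReal (RCLike.re (trace (regularization T ε ∘L A i)))) ε hε).trans hi'

/-! ### The `X`-norm -/

theorem xNorm_le {T : H →ₗ.[ℂ] H} {P M : H →L[ℂ] H} (hP : 0 ≤ P) (hP' : posTrace P < ∞)
    (hM : 0 ≤ M) (hM' : posTrace M < ∞) :
    xNorm T (P - M) ≤ energyTrace (oneAdd T) P + energyTrace (oneAdd T) M :=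
  sInf_le ⟨P, M, ⟨(ContinuousLinearMap.nonneg_iff_isPositive _).1 hP,
      (isTraceClass_iff_of_nonneg hP).2 hP'⟩,
    ⟨(ContinuousLinearMap.nonneg_iff_isPositive _).1 hM,
      (isTraceClass_iff_of_nonneg hM).2 hM'⟩, rfl, rfl⟩

theorem le_xNorm {T : H →ₗ.[ℂ] H} {γ : H →L[ℂ] H} {a : ℝ≥0∞}
    (h : ∀ P M : H →L[ℂ] H, 0 ≤ P → posTrace P < ∞ → 0 ≤ M → posTrace M < ∞ → γ = P - M →
      a ≤ energyTrace (oneAdd T) P + energyTrace (oneAdd T) M) : a ≤ xNorm T γ := by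
  refine le_sInf ?_
  rintro t ⟨P, M, ⟨hP, hP'⟩, ⟨hM, hM'⟩, hγ, rfl⟩
  rw [← ContinuousLinearMap.nonneg_iff_isPositive] at hP hM
  exact h P M hP ((isTraceClass_iff_of_nonneg hP).1 hP') hM
    ((isTraceClass_iff_of_nonneg hM).1 hM') hγ

theorem exists_of_xNorm_lt {T : H →ₗ.[ℂ] H} {γ : H →L[ℂ] H} {a : ℝ≥0∞} (h : xNorm T γ < a) :
    ∃ P M : H →L[ℂ] H, (0 ≤ P ∧ posTrace P < ∞) ∧ (0 ≤ M ∧ posTrace M < ∞) ∧ γ = P - M ∧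
      energyTrace (oneAdd T) P + energyTrace (oneAdd T) M < a := by
  by_contra! hc
  exact h.not_ge (le_xNorm fun P M hP hP' hM hM' hγ => hc P M ⟨hP, hP'⟩ ⟨hM, hM'⟩ hγ)

/-- `X⁺` is defined through `T` but the norm through `1 + T`; the two energies differ by at most the
trace, which is finite here. -/
theorem mem_XPos_iff {T : H →ₗ.[ℂ] H} (hT : IsPositiveOp T) {γ : H →L[ℂ] H} :
    γ ∈ XPos T ↔ (0 ≤ γ ∧ posTrace γ < ∞) ∧ energyTrace (oneAdd T) γ < ∞ := by
  rw [XPos, Set.mem_ofPred_eq, ← ContinuousLinearMap.nonneg_iff_isPositive]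
  constructor
  · rintro ⟨h1, h2, h3⟩
    rw [isTraceClass_iff_of_nonneg h1] at h2
    exact ⟨⟨h1, h2⟩, (energyTrace_oneAdd_le hT h1 h2).trans_lt (ENNReal.add_lt_top.2 ⟨h3, h2⟩)⟩
  · rintro ⟨⟨h1, h2⟩, h3⟩
    exact ⟨h1, (isTraceClass_iff_of_nonneg h1).2 h2,
      (energyTrace_le_energyTrace_oneAdd hT h1 h2).trans_lt h3⟩

/-- `X` is the set on which the `X`-norm is finite. -/
theorem mem_XSpace_iff {T : H →ₗ.[ℂ] H} (hT : IsPositiveOp T) {γ : H →L[ℂ] H} :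
    γ ∈ XSpace T ↔ xNorm T γ < ∞ := by
  constructor
  · rintro ⟨P, hP, M, hM, rfl⟩
    rw [mem_XPos_iff hT] at hP hM
    exact (xNorm_le hP.1.1 hP.1.2 hM.1.1 hM.1.2).trans_lt (ENNReal.add_lt_top.2 ⟨hP.2, hM.2⟩)
  · intro h
    obtain ⟨P, M, hP, hM, hγ, hE⟩ := exists_of_xNorm_lt h
    rw [ENNReal.add_lt_top] at hE
    exact ⟨P, (mem_XPos_iff hT).2 ⟨hP, hE.1⟩, M, (mem_XPos_iff hT).2 ⟨hM, hE.2⟩, hγ⟩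

/-! ### Algebraic properties of the `X`-norm -/

theorem energyTrace_zero (T : H →ₗ.[ℂ] H) : energyTrace T 0 = 0 := by
  simpa using energyTrace_smul T le_rfl (0 : H →L[ℂ] H)

theorem xNorm_zero (T : H →ₗ.[ℂ] H) : xNorm T 0 = 0 := by
  have h0 : posTrace (0 : H →L[ℂ] H) < ∞ := by simp [posTrace]
  have h := xNorm_le (T := T) le_rfl h0 le_rfl h0
  rwa [sub_zero, energyTrace_zero, add_zero, nonpos_iff_eq_zero] at h

theorem xNorm_add_le {T : H →ₗ.[ℂ] H} (hT : IsPositiveOp T) (γ₁ γ₂ : H →L[ℂ] H) :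
    xNorm T (γ₁ + γ₂) ≤ xNorm T γ₁ + xNorm T γ₂ := by
  -- Truncated subtraction isolates one infimum at a time, so no near-optimal decompositions are
  -- needed.
  rw [← tsub_le_iff_right]
  refine le_xNorm fun P₁ M₁ hP₁ hP₁' hM₁ hM₁' h₁ => ?_
  rw [tsub_le_iff_left, ← tsub_le_iff_right]
  refine le_xNorm fun P₂ M₂ hP₂ hP₂' hM₂ hM₂' h₂ => ?_
  rw [tsub_le_iff_right, h₁, h₂, sub_add_sub_comm]
  have hP : posTrace (P₁ + P₂) < ∞ := by
    rw [posTrace_add hP₁ hP₂]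
    exact ENNReal.add_lt_top.2 ⟨hP₁', hP₂'⟩
  have hM : posTrace (M₁ + M₂) < ∞ := by
    rw [posTrace_add hM₁ hM₂]
    exact ENNReal.add_lt_top.2 ⟨hM₁', hM₂'⟩
  refine (xNorm_le (add_nonneg hP₁ hP₂) hP (add_nonneg hM₁ hM₂) hM).trans ?_
  refine (add_le_add (energyTrace_add_le hT.oneAdd hP₁ hP₁' hP₂ hP₂')
    (energyTrace_add_le hT.oneAdd hM₁ hM₁' hM₂ hM₂')).trans_eq ?_
  abel

theorem xNorm_neg_le (T : H →ₗ.[ℂ] H) (γ : H →L[ℂ] H) : xNorm T (-γ) ≤ xNorm T γ := by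
  refine le_xNorm fun P M hP hP' hM hM' h => ?_
  rw [h, neg_sub, add_comm]
  exact xNorm_le hM hM' hP hP'

theorem xNorm_neg (T : H →ₗ.[ℂ] H) (γ : H →L[ℂ] H) : xNorm T (-γ) = xNorm T γ :=
  (xNorm_neg_le T γ).antisymm (by simpa using xNorm_neg_le T (-γ))

theorem xNorm_smul_le_of_pos (T : H →ₗ.[ℂ] H) {c : ℝ} (hc : 0 < c) (γ : H →L[ℂ] H) :
    xNorm T (c • γ) ≤ ENNReal.ofReal c * xNorm T γ := by
  have hc0 : ENNReal.ofReal c ≠ 0 := by simpa using hc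
  rw [mul_comm, ← ENNReal.div_le_iff hc0 ENNReal.ofReal_ne_top]
  refine le_xNorm fun P M hP hP' hM hM' h => ?_
  rw [ENNReal.div_le_iff hc0 ENNReal.ofReal_ne_top, h, smul_sub, mul_comm, mul_add,
    ← energyTrace_smul _ hc.le, ← energyTrace_smul _ hc.le]
  refine xNorm_le (smul_nonneg hc.le hP) ?_ (smul_nonneg hc.le hM) ?_
  all_goals
    rw [posTrace_smul hc.le]
    exact ENNReal.mul_lt_top ENNReal.ofReal_lt_top ‹_›

theorem xNorm_smul (T : H →ₗ.[ℂ] H) (c : ℝ) (γ : H →L[ℂ] H) :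
    xNorm T (c • γ) = ENNReal.ofReal |c| * xNorm T γ := by
  have hpos : ∀ {c : ℝ}, 0 < c → ∀ γ : H →L[ℂ] H,
      xNorm T (c • γ) = ENNReal.ofReal c * xNorm T γ := by
    intro c hc γ
    refine (xNorm_smul_le_of_pos T hc γ).antisymm ?_
    have h := xNorm_smul_le_of_pos T (inv_pos.2 hc) (c • γ)
    rw [inv_smul_smul₀ hc.ne'] at h
    calc ENNReal.ofReal c * xNorm T γ
        ≤ ENNReal.ofReal c * (ENNReal.ofReal c⁻¹ * xNorm T (c • γ)) := by gcongr
      _ = xNorm T (c • γ) := by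
        rw [← mul_assoc, ← ENNReal.ofReal_mul hc.le, mul_inv_cancel₀ hc.ne', ENNReal.ofReal_one,
          one_mul]
  rcases lt_trichotomy c 0 with hc | rfl | hc
  · rw [← xNorm_neg, ← neg_smul, hpos (neg_pos.2 hc), abs_of_neg hc]
  -- Valid even when the norm of `γ` is infinite, as `0 * ∞ = 0` in `ℝ≥0∞`.
  · simp [xNorm_zero]
  · rw [hpos hc, abs_of_pos hc]

/-- Norm ≤ trace ≤ twice the energy, for each piece of a decomposition. This gives definiteness and
makes `X`-Cauchy sequences Cauchy in operator norm. -/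
theorem ofReal_norm_le_xNorm {T : H →ₗ.[ℂ] H} (hT : IsPositiveOp T) (γ : H →L[ℂ] H) :
    ENNReal.ofReal ‖γ‖ ≤ 2 * xNorm T γ := by
  rw [mul_comm, ← ENNReal.div_le_iff (by simp) (by simp)]
  refine le_xNorm fun P M hP hP' hM hM' h => ?_
  rw [ENNReal.div_le_iff (by simp) (by simp), h, mul_comm, mul_add]
  refine (ENNReal.ofReal_le_ofReal (norm_sub_le P M)).trans (ENNReal.ofReal_add_le.trans ?_)
  exact add_le_add
    ((ofReal_norm_le_posTrace hP).trans (posTrace_le_two_mul_energyTrace_oneAdd hT hP hP'))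
    ((ofReal_norm_le_posTrace hM).trans (posTrace_le_two_mul_energyTrace_oneAdd hT hM hM'))

/-- Families of positive operators with bounded energy are compact in the weak operator topology. -/
theorem exists_tendsto_of_energyTrace_le {ι : Type*} (U : Ultrafilter ι) {T : H →ₗ.[ℂ] H}
    (hT : IsPositiveOp T) {A : ι → H →L[ℂ] H} {C : ℝ≥0∞} (hCt : C ≠ ∞)
    (hA : ∀ᶠ i in U, 0 ≤ A i ∧ posTrace (A i) < ∞)
    (hC : ∀ᶠ i in U, energyTrace (oneAdd T) (A i) ≤ C) :
    ∃ B : H →L[ℂ] H, (∀ x y, Tendsto (fun i => ⟪x, A i y⟫_ℂ) U (𝓝 ⟪x, B y⟫_ℂ)) ∧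
      0 ≤ B ∧ posTrace B < ∞ := by
  have htr : ∀ᶠ i in U, posTrace (A i) ≤ 2 * C := by
    filter_upwards [hA, hC] with i hi hi'
    exact (posTrace_le_two_mul_energyTrace_oneAdd hT hi.1 hi.2).trans (by gcongr)
  have h2C : 2 * C ≠ ∞ := ENNReal.mul_ne_top (by simp) hCt
  have hn : ∀ᶠ i in U, ‖A i‖ ≤ (2 * C).toReal := by
    filter_upwards [hA, htr] with i hi hi'
    rw [← ENNReal.ofReal_le_iff_le_toReal h2C]
    exact (ofReal_norm_le_posTrace hi.1).trans hi'
  obtain ⟨B, hB⟩ := exists_tendsto_inner_of_bounded U hn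
  refine ⟨B, hB, ?_, (tsum_re_inner_le_of_tendsto hB _ htr).trans_lt h2C.lt_top⟩
  rw [ContinuousLinearMap.nonneg_iff_isPositive]
  refine isPositive_of_tendsto_inner ?_ hB
  filter_upwards [hA] with i hi
  exact (ContinuousLinearMap.nonneg_iff_isPositive _).1 hi.1

/-- The sublevel sets of the `X`-norm are closed in the weak operator topology. -/
theorem xNorm_le_of_tendsto {ι : Type*} {F : Filter ι} {T : H →ₗ.[ℂ] H}
    (hT : IsPositiveOp T) {A : ι → H →L[ℂ] H} {B : H →L[ℂ] H}
    (h : ∀ x y, Tendsto (fun i => ⟪x, A i y⟫_ℂ) F (𝓝 ⟪x, B y⟫_ℂ)) {C : ℝ≥0∞}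
    (hC : ∃ᶠ i in F, xNorm T (A i) < C) : xNorm T B ≤ C := by
  rcases eq_or_ne C ∞ with rfl | hCt
  · exact le_top
  have hne : (F ⊓ 𝓟 {i | xNorm T (A i) < C}).NeBot := frequently_mem_iff_neBot.1 hC
  -- The bound holds only frequently along `F`; an ultrafilter refining `F` makes it eventual and
  -- supplies compactness.
  obtain ⟨U, hU⟩ := Ultrafilter.exists_le (F ⊓ 𝓟 {i | xNorm T (A i) < C})
  have hUF : (U : Filter ι) ≤ F := hU.trans inf_le_left
  have hUC : ∀ᶠ i in U, xNorm T (A i) < C := le_principal_iff.1 (hU.trans inf_le_right)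
  have hdec : ∀ i, ∃ P M : H →L[ℂ] H, xNorm T (A i) < C → (0 ≤ P ∧ posTrace P < ∞) ∧
      (0 ≤ M ∧ posTrace M < ∞) ∧ A i = P - M ∧
      energyTrace (oneAdd T) P + energyTrace (oneAdd T) M < C := by
    intro i
    by_cases hi : xNorm T (A i) < C
    · obtain ⟨P, M, hPM⟩ := exists_of_xNorm_lt hi
      exact ⟨P, M, fun _ => hPM⟩
    · exact ⟨0, 0, fun hi' => absurd hi' hi⟩
  choose P M hPM using hdec
  have hP : ∀ᶠ i in U, 0 ≤ P i ∧ posTrace (P i) < ∞ := hUC.mono fun i hi => (hPM i hi).1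
  have hM : ∀ᶠ i in U, 0 ≤ M i ∧ posTrace (M i) < ∞ := hUC.mono fun i hi => (hPM i hi).2.1
  have hsum : ∀ᶠ i in U, energyTrace (oneAdd T) (P i) + energyTrace (oneAdd T) (M i) ≤ C :=
    hUC.mono fun i hi => (hPM i hi).2.2.2.le
  obtain ⟨P', hPt, hP0, hPtr⟩ := exists_tendsto_of_energyTrace_le U hT hCt hP
    (hsum.mono fun i hi => le_self_add.trans hi)
  obtain ⟨M', hMt, hM0, hMtr⟩ := exists_tendsto_of_energyTrace_le U hT hCt hM
    (hsum.mono fun i hi => le_add_self.trans hi)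
  -- Only the sum of the two energies is bounded by `C`, so each must have its own limit, by
  -- compactness of `[0, ∞]`, before they are added.
  have hlim : ∀ f : ι → ℝ≥0∞, ∃ a, Tendsto f U (𝓝 a) := by
    intro f
    obtain ⟨a, -, ha⟩ := isCompact_univ.ultrafilter_le_nhds (U.map f) (by simp)
    exact ⟨a, ha⟩
  have hlsc : ∀ {R : ι → H →L[ℂ] H} {R' : H →L[ℂ] H} {a : ℝ≥0∞},
      (∀ᶠ i in U, 0 ≤ R i ∧ posTrace (R i) < ∞) →
      (∀ x y, Tendsto (fun i => ⟪x, R i y⟫_ℂ) U (𝓝 ⟪x, R' y⟫_ℂ)) → 0 ≤ R' → posTrace R' < ∞ →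
      Tendsto (fun i => energyTrace (oneAdd T) (R i)) U (𝓝 a) →
      energyTrace (oneAdd T) R' ≤ a := by
    intro R R' a hR hRt hR0 hRtr ha
    refine le_of_forall_gt_imp_ge_of_dense fun b hb => ?_
    exact energyTrace_le_of_tendsto hT.oneAdd hRt hR hR0 hRtr ((ha.eventually_lt_const hb).mono
      fun i hi => hi.le)
  obtain ⟨a, ha⟩ := hlim fun i => energyTrace (oneAdd T) (P i)
  obtain ⟨b, hb⟩ := hlim fun i => energyTrace (oneAdd T) (M i)
  have hB : B = P' - M' := by
    refine ContinuousLinearMap.ext fun y => ext_inner_left ℂ fun x => ?_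
    refine tendsto_nhds_unique ((h x y).mono_left hUF) ?_
    rw [sub_apply, inner_sub_right]
    refine ((hPt x y).sub (hMt x y)).congr' ?_
    filter_upwards [hUC] with i hi
    rw [(hPM i hi).2.2.1, sub_apply, inner_sub_right]
  rw [hB]
  refine (xNorm_le hP0 hPtr hM0 hMtr).trans ((add_le_add (hlsc hP hPt hP0 hPtr ha)
    (hlsc hM hMt hM0 hMtr hb)).trans ?_)
  exact le_of_tendsto (ha.add hb) hsum

theorem xNorm_le_liminf {ι : Type*} {F : Filter ι} {T : H →ₗ.[ℂ] H}
    (hT : IsPositiveOp T) {A : ι → H →L[ℂ] H} {B : H →L[ℂ] H}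
    (h : ∀ x y, Tendsto (fun i => ⟪x, A i y⟫_ℂ) F (𝓝 ⟪x, B y⟫_ℂ)) :
    xNorm T B ≤ liminf (fun i => xNorm T (A i)) F :=
  le_of_forall_gt_imp_ge_of_dense fun _ hb =>
    xNorm_le_of_tendsto hT h (frequently_lt_of_liminf_lt (by isBoundedDefault) hb)

theorem tendsto_inner_of_tendsto_trace {ι : Type*} {F : Filter ι} {A : ι → H →L[ℂ] H}
    {B : H →L[ℂ] H} (h : ∀ V : H →L[ℂ] H, IsCompactOperator V →
      Tendsto (fun i => trace (V ∘L A i)) F (𝓝 (trace (V ∘L B)))) (x y : H) :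
    Tendsto (fun i => ⟪x, A i y⟫_ℂ) F (𝓝 ⟪x, B y⟫_ℂ) := by
  simpa only [trace_rankOne_comp] using h _ (isCompactOperator_rankOne x y)

theorem lowerSemicontinuous_xNorm {T : H →ₗ.[ℂ] H} (hT : IsPositiveOp T) :
    LowerSemicontinuous fun γ : TraceClass H => xNorm T γ.op := by
  intro γ
  refine lowerSemicontinuousAt_iff_le_liminf.2 ?_
  refine xNorm_le_liminf hT (tendsto_inner_of_tendsto_trace fun V hV => ?_)
  have h : Continuous fun A : TraceClass H =>
      fun V : {V : H →L[ℂ] H // IsCompactOperator V} => trace ((V : H →L[ℂ] H) ∘L A.op) :=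
    continuous_induced_dom
  exact ((continuous_apply (⟨V, hV⟩ : {V : H →L[ℂ] H // IsCompactOperator V})).comp h).tendsto γ

/-! ### Completeness -/

theorem tendsto_inner_of_tendsto {ι : Type*} {F : Filter ι} {A : ι → H →L[ℂ] H} {B : H →L[ℂ] H}
    (h : Tendsto A F (𝓝 B)) (x y : H) : Tendsto (fun i => ⟪x, A i y⟫_ℂ) F (𝓝 ⟪x, B y⟫_ℂ) :=
  tendsto_const_nhds.inner (((ContinuousLinearMap.apply ℂ H y).continuous.tendsto B).comp h)

/-- `X` as a real linear subspace. -/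
def xSubmodule {T : H →ₗ.[ℂ] H} (hT : IsPositiveOp T) : Submodule ℝ (H →L[ℂ] H) where
  carrier := XSpace T
  add_mem' {a b} ha hb := by
    rw [mem_XSpace_iff hT] at ha hb ⊢
    exact (xNorm_add_le hT a b).trans_lt (ENNReal.add_lt_top.2 ⟨ha, hb⟩)
  zero_mem' := by
    rw [mem_XSpace_iff hT, xNorm_zero]
    exact ENNReal.zero_lt_top
  smul_mem' c a ha := by
    rw [mem_XSpace_iff hT] at ha ⊢
    rw [xNorm_smul]
    exact ENNReal.mul_lt_top ENNReal.ofReal_lt_top ha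

theorem norm_le_two_mul_toReal_xNorm {T : H →ₗ.[ℂ] H} (hT : IsPositiveOp T)
    (γ : xSubmodule hT) : ‖(γ : H →L[ℂ] H)‖ ≤ 2 * (xNorm T γ).toReal := by
  have hγ : xNorm T γ < ∞ := (mem_XSpace_iff hT).1 γ.2
  have h := ofReal_norm_le_xNorm hT (γ : H →L[ℂ] H)
  rwa [ENNReal.ofReal_le_iff_le_toReal (ENNReal.mul_ne_top (by simp) hγ.ne),
    ENNReal.toReal_mul, ENNReal.toReal_ofNat] at h

/-- States completeness through the bare norm, so that the argument can work with `xNorm` directly.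
-/
theorem completeSpace_ofCore {E : Type*} [AddCommGroup E] [Module ℝ E] [Norm E]
    (core : NormedSpace.Core ℝ E)
    (h : ∀ u : ℕ → E, (∀ ε > 0, ∃ N, ∀ m ≥ N, ∀ n ≥ N, ‖u m - u n‖ < ε) →
      ∃ x, ∀ ε > 0, ∃ N, ∀ n ≥ N, ‖u n - x‖ < ε) :
    letI : NormedAddCommGroup E := NormedAddCommGroup.ofCore core
    CompleteSpace E := by
  let : NormedAddCommGroup E := NormedAddCommGroup.ofCore core
  refine Metric.complete_of_cauchySeq_tendsto fun u hu => ?_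
  simp_rw [Metric.cauchySeq_iff, dist_eq_norm] at hu
  simp_rw [Metric.tendsto_atTop, dist_eq_norm]
  exact h u hu

theorem isRealBanachSpace_XSpace {T : H →ₗ.[ℂ] H} (hT : IsPositiveOp T) :
    IsRealBanachSpace (XSpace T) (xNorm T) := by
  have hfin : ∀ x : xSubmodule hT, xNorm T x ≠ ∞ := fun x => ((mem_XSpace_iff hT).1 x.2).ne
  refine ⟨xSubmodule hT, rfl, fun x hx => (mem_XSpace_iff hT).1 hx, ?_⟩
  let : Norm (xSubmodule hT) := ⟨fun x => (xNorm T x).toReal⟩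
  have hnorm : ∀ x : xSubmodule hT, ‖x‖ = (xNorm T x).toReal := fun _ => rfl
  have core : NormedSpace.Core ℝ (xSubmodule hT) :=
    { norm_nonneg := fun x => ENNReal.toReal_nonneg
      norm_smul := fun c x => by
        rw [hnorm, hnorm, Submodule.coe_smul, xNorm_smul, ENNReal.toReal_mul,
          ENNReal.toReal_ofReal (abs_nonneg c), Real.norm_eq_abs]
      norm_triangle := fun x y => by
        rw [hnorm, hnorm, hnorm, ← ENNReal.toReal_add (hfin x) (hfin y)]
        exact ENNReal.toReal_mono (ENNReal.add_ne_top.2 ⟨hfin x, hfin y⟩) (xNorm_add_le hT _ _)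
      norm_eq_zero_iff := fun x => by
        constructor
        · intro h
          have h1 := norm_le_two_mul_toReal_xNorm hT x
          rw [← hnorm, h, mul_zero] at h1
          exact Subtype.ext (norm_le_zero_iff.1 h1)
        · rintro rfl
          rw [hnorm, Submodule.coe_zero, xNorm_zero, ENNReal.toReal_zero] }
  refine ⟨core, ?_⟩
  refine completeSpace_ofCore core fun u hu => ?_
  have hv : CauchySeq fun n => (u n : H →L[ℂ] H) := by
    refine Metric.cauchySeq_iff.2 fun ε hε => ?_
    obtain ⟨N, hN⟩ := hu (ε / 2) (half_pos hε)
    refine ⟨N, fun m hm n hn => ?_⟩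
    have h1 := hN m hm n hn
    rw [hnorm, Submodule.coe_sub] at h1
    have h2 := norm_le_two_mul_toReal_xNorm hT (u m - u n)
    rw [Submodule.coe_sub] at h2
    rw [dist_eq_norm]
    linarith
  obtain ⟨B, hB⟩ := cauchySeq_tendsto_of_complete hv
  -- Fix `n` and let `m → ∞` in `u n - u m`: the sublevel sets of the `X`-norm are weakly closed.
  have key : ∀ ε > 0, ∃ N, ∀ n ≥ N, xNorm T (u n - B) ≤ ENNReal.ofReal ε := by
    intro ε hε
    obtain ⟨N, hN⟩ := hu ε hε
    refine ⟨N, fun n hn => xNorm_le_of_tendsto hT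
      (tendsto_inner_of_tendsto (hB.const_sub (u n : H →L[ℂ] H))) (Eventually.frequently ?_)⟩
    filter_upwards [eventually_ge_atTop N] with m hm
    have h1 := hN n hn m hm
    rw [hnorm, Submodule.coe_sub] at h1
    exact (ENNReal.lt_ofReal_iff_toReal_lt (hfin (u n - u m))).2 h1
  -- `B` is `u N` minus `u N - B`, and the latter has finite `X`-norm.
  have hBX : B ∈ xSubmodule hT := by
    obtain ⟨N, hN⟩ := key 1 one_pos
    have h1 : (u N : H →L[ℂ] H) - B ∈ xSubmodule hT :=
      (mem_XSpace_iff hT).2 ((hN N le_rfl).trans_lt ENNReal.ofReal_lt_top)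
    simpa using (xSubmodule hT).sub_mem (u N).2 h1
  refine ⟨⟨B, hBX⟩, fun ε hε => ?_⟩
  -- Passing to the limit gave only `≤`; halving `ε` restores the strict inequality.
  obtain ⟨N, hN⟩ := key (ε / 2) (half_pos hε)
  refine ⟨N, fun n hn => ?_⟩
  rw [hnorm, Submodule.coe_sub]
  refine (ENNReal.toReal_le_of_le_ofReal (half_pos hε).le (hN n hn)).trans_lt (half_lt_self hε)

end Unbounded

end RDM
end

theorem mainTheorem4 {H : Type*} [NormedAddCommGroup H] [InnerProductSpace ℂ H] [CompleteSpace H]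
    [TopologicalSpace.SeparableSpace H] (T : H →ₗ.[ℂ] H) (hT : RDM.IsPositiveOp T) :
    LowerSemicontinuous (fun γ : RDM.TraceClass H => RDM.xNorm T γ.op) ∧
    (∀ (γs : ℕ → RDM.TraceClass H) (γ : RDM.TraceClass H),
      (∀ V : H →L[ℂ] H, IsCompactOperator V →
        Tendsto (fun n => RDM.trace (V ∘L ((γs n).op - γ.op))) atTop (𝓝 0)) →
      RDM.xNorm T γ.op ≤ liminf (fun n => RDM.xNorm T (γs n).op) atTop) ∧
    (∀ γ ∈ RDM.XSpace T, RDM.IsTraceClass γ ∧ IsSelfAdjoint γ) ∧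
    RDM.IsRealBanachSpace (RDM.XSpace T) (RDM.xNorm T) := by
  refine ⟨RDM.lowerSemicontinuous_xNorm hT, fun γs γ h => ?_, ?_, RDM.isRealBanachSpace_XSpace hT⟩
  · refine RDM.xNorm_le_liminf hT fun x y => ?_
    have h1 := h _ (RDM.isCompactOperator_rankOne x y)
    simp only [RDM.trace_rankOne_comp, sub_apply, inner_sub_right] at h1
    exact tendsto_sub_nhds_zero_iff.1 h1
  · rintro γ ⟨P, ⟨hP, hP', -⟩, M, ⟨hM, hM', -⟩, rfl⟩
    refine ⟨?_, hP.isSelfAdjoint.sub hM.isSelfAdjoint⟩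
    rw [← ContinuousLinearMap.nonneg_iff_isPositive] at hP hM
    exact RDM.IsTraceClass.sub hP hM hP' hM'
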